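/- There are real constants $\alpha_{\{k_1,\dots,k_m\}}$, one for each finite multiset $\{k_1,\dots,k_m\}$ of integers $k_i\ge 3$ with $m\ge 3$ and even sum, such that the following holds. Let $K\ge 3$, let $Z$ be a real random variable with $\mathbb{E}|Z|^{2K}<\infty$, and for each $\sigma_N>0$ let $N\sim\mathcal N(0,\sigma_N^2)$ be independent of $Z$, $Y=Z+N$, $\mu=\mathbb{E}(Y)$ and $\sigma^2=\mathrm{Var}(Y)$ (so $\sigma\to\infty$ as $\sigma_N\to\infty$). Let $f$ be the density of $(Y-\mu)/\sigma$, let $g$ be the standard normal density, and let $D(f\|g)=\int f\log\frac fg$ (natural logarithm). Let $\kappa_k$ denote the $k$-th cumulant of $Z$, $\kappa_k=i^{-k}\frac{d^k}{dt^k}\log\mathbb{E}(e^{itZ})\big|_{t=0}$, and define the modified moments $\widetilde m_k$, $k\ge3$, by $$\widetilde m_k=\kappa_k+\sum_{j=3}^{k-3}\binom{k-1}{j}\widetilde m_j\,\kappa_{k-j}.$$ Then for $3\le k\le 2K$ the $k$-th cumulant of $Y$ equals $\kappa_k$, whatever $\sigma_N>0$; $D(f\|g)$ is finite for every $\sigma_N>0$;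 and, as $\sigma_N\to\infty$, $$D(f\|g)=\sum_{k=3}^K\frac{c_k}{2\,k!\,\sigma^{2k}}+o\Bigl(\frac1{\sigma^{2K}}\Bigr),\qquad c_k=\widetilde m_k^2+\sum_{\{k_1,\dots,k_m\}}\alpha_{\{k_1,\dots,k_m\}}\,\widetilde m_{k_1}\widetilde m_{k_2}\cdots\widetilde m_{k_m},$$ where the last sum runs over all multisets $\{k_1,\dots,k_m\}$ with $m\ge 3$, all $k_i\ge 3$ and $k_1+\cdots+k_m=2k$. In particular only even powers of $1/\sigma$ occur. -/

import Mathlib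

open MeasureTheory ProbabilityTheory InformationTheory Filter Asymptotics
open scoped Nat ENNReal

/-- The `k`-th cumulant of a real random variable `X`: `i ^ (-k)` times the `k`-th derivative at `0`
of the logarithm of the characteristic function `t ↦ E[exp (i t X)]`. (When `X` has a finite moment
of order `k` this number exists and is real.) -/
noncomputable def cumulant {Ω : Type*} [MeasurableSpace Ω] (X : Ω → ℝ) (P : Measure Ω)
    (k : ℕ) : ℝ :=
  ((Complex.I ^ k)⁻¹ * iteratedDeriv k (fun t : ℝ => Complex.log (charFun (P.map X) t)) 0).re

/-- The modified moments attached to a sequence `κ` of cumulants: `m̃₀ = 1`, `m̃₁ = m̃₂ = 0`, and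
`m̃ₖ = κₖ + ∑_{j=3}^{k-3} (k-1 choose j) m̃ⱼ κₖ₋ⱼ` for `k ≥ 3`. -/
noncomputable def modifiedMoment (κ : ℕ → ℝ) (k : ℕ) : ℝ :=
  if k = 0 then 1
  else if k < 3 then 0
  else κ k + ∑ j ∈ (Finset.Icc 3 (k - 3)).attach,
    ((k - 1).choose j.1 : ℝ) * modifiedMoment κ j.1 * κ (k - j.1)
termination_by k
decreasing_by
  have := Finset.mem_Icc.mp j.2
  omega

theorem modifiedMoment_zero (κ : ℕ → ℝ) : modifiedMoment κ 0 = 1 := by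
  rw [modifiedMoment]; simp

theorem modifiedMoment_one (κ : ℕ → ℝ) : modifiedMoment κ 1 = 0 := by
  rw [modifiedMoment]; simp

theorem modifiedMoment_two (κ : ℕ → ℝ) : modifiedMoment κ 2 = 0 := by
  rw [modifiedMoment]; simp

/-- The recursion of the modified moments, as a plain sum. -/
theorem modifiedMoment_of_three_le (κ : ℕ → ℝ) {k : ℕ} (hk : 3 ≤ k) :
    modifiedMoment κ k = κ k + ∑ j ∈ Finset.Icc 3 (k - 3),
      ((k - 1).choose j : ℝ) * modifiedMoment κ j * κ (k - j) := by
  rw [modifiedMoment, if_neg (by omega), if_neg (by omega),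
    Finset.sum_attach (Finset.Icc 3 (k - 3))
      (fun j => ((k - 1).choose j : ℝ) * modifiedMoment κ j * κ (k - j))]

/-- The standard deviation of a real random variable. -/
noncomputable def stdDev {Ω : Type*} [MeasurableSpace Ω] (Y : Ω → ℝ) (P : Measure Ω) : ℝ :=
  √(Var[Y; P])

/-- The non-Gaussianity `D(f ‖ g)` of `Y`: the Kullback-Leibler divergence (in nats) of the law `f`
of the standardized variable `(Y - E Y) / σ_Y` from the standard normal law `g`. -/
noncomputable def nonGaussianity {Ω : Type*} [MeasurableSpace Ω] (Y : Ω → ℝ) (P : Measure Ω) :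
    ℝ≥0∞ :=
  klDiv (P.map (fun ω => (Y ω - P[Y]) / stdDev Y P)) (gaussianReal 0 1)

/-- `m̃ₖ²` plus a sum of terms `α · m̃_{k₁} ⋯ m̃_{kₘ}`, one for each multiset `{k₁, …, kₘ}` with
`m ≥ 3`, all `kᵢ ≥ 3` and `k₁ + ⋯ + kₘ = 2k`, with coefficients given by `α`. -/
noncomputable def divergenceCoeff (α : (k : ℕ) → Nat.Partition (2 * k) → ℝ) (m : ℕ → ℝ) (k : ℕ) :
    ℝ :=
  m k ^ 2 + ∑ p : Nat.Partition (2 * k) with 3 ≤ p.parts.card ∧ ∀ i ∈ p.parts, 3 ≤ i,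
    α k p * (p.parts.map m).prod

/-! Put `v = Var Z`, `ε = 1/σ`, `θ = v ε²`, and let `ρ` be the law of the centred `Z`. The
standardized `Y` is a mixture over `z ~ ρ` of normal laws with mean `ε z` and variance `1 - θ`. Its
density `h` with respect to the standard normal law `γ` is the mixture of the kernels `mehlerKernel
θ (ε z)`, and the divergence is `∫ klFun h dγ`, where `klFun x = x log x + 1 - x`.

The kernel is an average of the Hermite generating function at `ε (z + i √v G)`, `G` standard normal
(`mehlerKernel_eq_integral`). Expanding it and integrating in `z` formally gives `h = ∑ ε^k E[(Z -
EZ + i √v G)^k] He_k / k!`. The coefficients are Taylor coefficients of `charFun ρ t * exp (v t² /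
2)`. The logarithm of this function has the cumulants of `Z` from order 3 on and nothing below, and
its logarithmic derivative yields the recursion of the modified moments
(`integral_gaussianShiftMoment_eq`). Hence `h = 1 + p + (error)` with `p = O(ε³)` the polynomial
`hermiteSum`.

Only `n = 2K` moments exist, so the expansion is justified on `|ε z| ≤ 1`, where the error is
`o(ε^n)` with a weight `exp (δ x²)`, `δ` as small as desired (`exists_abs_mixtureDensity_sub_le`).
The remaining `z` add a nonnegative piece `b` to the truncated density. Since `klFun` has derivative
`log`, and the logarithms of the truncated and full densities are at most of size `4 (1 + x²)`, this
changes the divergence by at most `4 ∫ (1 + x²) b dγ`, a truncated second moment which is again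
`o(ε^n)`. As `klFun` needs no normalization, the truncated density may have mass less than one.

It remains to integrate the Taylor polynomial of `klFun (1 + u)` at `u = p`. By orthogonality the
quadratic term gives `∑ m̃_k² ε^(2k) / (2 k!)`. The higher powers give one universal coefficient per
multiset, an integral of a product of Hermite polynomials, which vanishes by parity when the sum of
the multiset is odd. -/

/-! ### Hermite polynomials in the Gaussian L² space. -/

section GaussianPolynomials

open Polynomial

/-- Completing the square. Polynomial and exponential growth is thus absorbed into a weight `exp (δ
x²)`, which is `γ`-integrable for `δ < 1/2`. -/
lemma exp_le_exp_mul_sq {δ : ℝ} (hδ : 0 < δ) (a x : ℝ) :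
    Real.exp (a * |x|) ≤ Real.exp (a ^ 2 / (4 * δ)) * Real.exp (δ * x ^ 2) := by
  rw [← Real.exp_add]
  apply Real.exp_le_exp.2
  have h : 0 ≤ δ * (|x| - a / (2 * δ)) ^ 2 := by positivity
  have h2 : δ * (|x| - a / (2 * δ)) ^ 2 = δ * |x| ^ 2 - a * |x| + a ^ 2 / (4 * δ) := by
    field_simp
    ring
  rw [sq_abs] at h2
  linarith

lemma exists_abs_eval_le_exp_sq (p : ℝ[X]) {δ : ℝ} (hδ : 0 < δ) :
    ∃ C : ℝ, 0 ≤ C ∧ ∀ x : ℝ, |p.eval x| ≤ C * Real.exp (δ * x ^ 2) := by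
  induction p using Polynomial.induction_on' with
  | add p q hp hq =>
    obtain ⟨C, hC, h⟩ := hp
    obtain ⟨D, hD, h'⟩ := hq
    refine ⟨C + D, by positivity, fun x => ?_⟩
    rw [eval_add, add_mul]
    exact (abs_add_le _ _).trans (add_le_add (h x) (h' x))
  | monomial n a =>
    refine ⟨|a| * (n ! * Real.exp (1 ^ 2 / (4 * δ))), by positivity, fun x => ?_⟩
    have h1 : |x| ^ n ≤ n ! * Real.exp (1 * |x|) := by
      have := Real.pow_div_factorial_le_exp |x| (abs_nonneg x) n
      rw [div_le_iff₀ (by positivity)] at this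
      rw [one_mul]
      linarith
    rw [eval_monomial, abs_mul, abs_pow, mul_assoc, mul_assoc]
    gcongr
    exact h1.trans (by gcongr; exact exp_le_exp_mul_sq hδ 1 x)

lemma integrable_gaussianReal_iff {E : Type*} [NormedAddCommGroup E] [NormedSpace ℝ E]
    {f : ℝ → E} :
    Integrable f (gaussianReal 0 1) ↔ Integrable (fun x => gaussianPDFReal 0 1 x • f x) := by
  rw [gaussianReal_of_var_ne_zero _ one_ne_zero,
    integrable_withDensity_iff_integrable_smul' (measurable_gaussianPDF _ _)
      (ae_of_all _ fun _ => gaussianPDF_lt_top)]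
  simp

lemma gaussianPDFReal_zero_one (x : ℝ) :
    gaussianPDFReal 0 1 x = (√(2 * Real.pi))⁻¹ * Real.exp (-x ^ 2 / 2) := by
  simp [gaussianPDFReal]

lemma integrable_exp_mul_sq {c : ℝ} (hc : c < 1 / 2) :
    Integrable (fun x => Real.exp (c * x ^ 2)) (gaussianReal 0 1) := by
  rw [integrable_gaussianReal_iff]
  have := (integrable_exp_neg_mul_sq (b := 1 / 2 - c) (by linarith)).const_mul (√(2 * Real.pi))⁻¹
  refine this.congr (ae_of_all _ fun x => ?_)
  simp only [gaussianPDFReal_zero_one, smul_eq_mul]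
  rw [mul_assoc, ← Real.exp_add]
  congr 2
  ring

lemma integrable_eval_gaussianReal (p : ℝ[X]) :
    Integrable (fun x => p.eval x) (gaussianReal 0 1) := by
  obtain ⟨C, -, h⟩ := exists_abs_eval_le_exp_sq p (δ := 1 / 4) (by norm_num)
  refine ((integrable_exp_mul_sq (c := 1 / 4) (by norm_num)).const_mul C).mono'
    p.continuous.aestronglyMeasurable (ae_of_all _ fun x => ?_)
  exact h x

/-- Stein's identity for polynomials. -/
lemma integral_X_mul_eval_gaussianReal (p : ℝ[X]) :
    ∫ x, (X * p).eval x ∂(gaussianReal 0 1) = ∫ x, p.derivative.eval x ∂(gaussianReal 0 1) := by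
  have hd : ∀ x, HasDerivAt (fun x => gaussianPDFReal 0 1 x * p.eval x)
      (gaussianPDFReal 0 1 x • (p.derivative - X * p).eval x) x := by
    intro x
    have h1 : HasDerivAt (fun x : ℝ => gaussianPDFReal 0 1 x) (-x * gaussianPDFReal 0 1 x) x := by
      simp only [gaussianPDFReal_zero_one]
      have := (((hasDerivAt_pow 2 x).neg.div_const 2).exp).const_mul (√(2 * Real.pi))⁻¹
      convert! this using 1
      simp
      ring
    convert! h1.mul (p.hasDerivAt x) using 1
    simp
    ring
  have h0 := integral_eq_zero_of_hasDerivAt_of_integrable hd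
    (integrable_gaussianReal_iff.1 (integrable_eval_gaussianReal _))
    (integrable_gaussianReal_iff.1 (integrable_eval_gaussianReal p))
  rw [← integral_gaussianReal_eq_integral_smul one_ne_zero] at h0
  simp only [eval_sub] at h0
  rw [integral_sub (integrable_eval_gaussianReal _) (integrable_eval_gaussianReal _)] at h0
  linarith

/-- Integration by parts `k` times: in `He_(k+1) = X He_k - He_k'`, Stein's identity turns the
factor `X` into a derivative, and only the derivative falling on `p` survives. -/
lemma integral_hermite_mul (k : ℕ) (p : ℝ[X]) :
    ∫ x, ((hermite k).map (Int.castRingHom ℝ) * p).eval x ∂(gaussianReal 0 1) =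
      ∫ x, (derivative^[k] p).eval x ∂(gaussianReal 0 1) := by
  induction k generalizing p with
  | zero => simp [hermite_zero]
  | succ k ih =>
    have h1 := integral_X_mul_eval_gaussianReal ((hermite k).map (Int.castRingHom ℝ) * p)
    have h2 : (hermite (k + 1)).map (Int.castRingHom ℝ) * p =
        X * ((hermite k).map (Int.castRingHom ℝ) * p) -
          derivative ((hermite k).map (Int.castRingHom ℝ) * p) +
          (hermite k).map (Int.castRingHom ℝ) * derivative p := by
      rw [hermite_succ, Polynomial.map_sub, Polynomial.map_mul, derivative_mul, derivative_map,
        map_X]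
      ring
    rw [h2]
    simp only [eval_add, eval_sub]
    rw [integral_add, integral_sub, h1, sub_self, zero_add, ih, Function.iterate_succ_apply]
    · exact integrable_eval_gaussianReal _
    · exact integrable_eval_gaussianReal _
    · exact (integrable_eval_gaussianReal _).sub (integrable_eval_gaussianReal _)
    · exact integrable_eval_gaussianReal _

/-- The Hermite polynomial of degree `k` divided by `k!`, with real coefficients. -/
noncomputable def scaledHermite (k : ℕ) : ℝ[X] :=
  C (k ! : ℝ)⁻¹ * (hermite k).map (Int.castRingHom ℝ)

lemma natDegree_map_hermite (k : ℕ) :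
    ((hermite k).map (Int.castRingHom ℝ)).natDegree = k := by
  rw [(hermite_monic k).natDegree_map, natDegree_hermite]

/-- For `l < k` the `k`-th derivative kills the factor of degree `l`; for `l = k` it leaves `k!`,
the leading coefficient being one. -/
lemma integral_scaledHermite_mul (k l : ℕ) :
    ∫ x, (scaledHermite k * scaledHermite l).eval x ∂(gaussianReal 0 1) =
      if k = l then (k ! : ℝ)⁻¹ else 0 := by
  have key : ∀ k l, l ≤ k →
      ∫ x, (scaledHermite k * scaledHermite l).eval x ∂(gaussianReal 0 1) =
        if k = l then (k ! : ℝ)⁻¹ else 0 := by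
    intro k l hlk
    have h1 : scaledHermite k * scaledHermite l = C ((k ! : ℝ)⁻¹ * (l ! : ℝ)⁻¹) *
        ((hermite k).map (Int.castRingHom ℝ) * (hermite l).map (Int.castRingHom ℝ)) := by
      simp only [scaledHermite, C_mul]
      ring
    simp only [h1]
    simp only [eval_mul (p := C _), eval_C]
    rw [integral_const_mul, integral_hermite_mul]
    split_ifs with h
    · subst h
      have : derivative^[k] ((hermite k).map (Int.castRingHom ℝ)) = C (k ! : ℝ) := by
        have hd : (derivative^[k] ((hermite k).map (Int.castRingHom ℝ))).natDegree ≤ 0 := by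
          refine (natDegree_iterate_derivative _ k).trans ?_
          rw [natDegree_map_hermite, Nat.sub_self]
        rw [eq_C_of_natDegree_le_zero hd, coeff_iterate_derivative]
        simp [Nat.descFactorial_self]
      rw [this]
      simp [Nat.factorial_ne_zero]
    · rw [iterate_derivative_eq_zero (by rw [natDegree_map_hermite]; omega)]
      simp
  rcases le_total l k with h | h
  · exact key k l h
  · rw [mul_comm, key l k h]
    by_cases hkl : k = l
    · simp [hkl]
    · rw [if_neg hkl, if_neg (Ne.symm hkl)]

lemma eval_neg_hermite (k : ℕ) (x : ℝ) :
    ((hermite k).map (Int.castRingHom ℝ)).eval (-x) =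
      (-1) ^ k * ((hermite k).map (Int.castRingHom ℝ)).eval x := by
  induction k generalizing x with
  | zero => simp
  | succ k ih =>
    have hd : (derivative ((hermite k).map (Int.castRingHom ℝ))).eval (-x) =
        -((-1) ^ k * (derivative ((hermite k).map (Int.castRingHom ℝ))).eval x) := by
      have h1 := ((Polynomial.hasDerivAt ((hermite k).map (Int.castRingHom ℝ)) (-x)).comp x
        (hasDerivAt_neg x))
      have h2 := (Polynomial.hasDerivAt ((hermite k).map (Int.castRingHom ℝ)) x).const_mul
        ((-1 : ℝ) ^ k)
      have := h1.unique (h2.congr_of_eventuallyEq (Eventually.of_forall fun y => ih y))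
      linarith
    rw [hermite_succ, Polynomial.map_sub, Polynomial.map_mul, derivative_map, map_X] at *
    simp only [eval_sub, eval_mul, eval_X, ih, hd]
    ring

lemma eval_neg_scaledHermite (k : ℕ) (x : ℝ) :
    (scaledHermite k).eval (-x) = (-1) ^ k * (scaledHermite k).eval x := by
  simp only [scaledHermite, eval_mul, eval_C, eval_neg_hermite]
  ring

lemma eval_neg_prod_scaledHermite (s : Multiset ℕ) (x : ℝ) :
    ((s.map scaledHermite).prod).eval (-x) =
      (-1) ^ s.sum * ((s.map scaledHermite).prod).eval x := by
  induction s using Multiset.induction with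
  | empty => simp
  | cons a s ih =>
    simp only [Multiset.map_cons, Multiset.prod_cons, eval_mul, ih, eval_neg_scaledHermite,
      Multiset.sum_cons, pow_add]
    ring

lemma integral_comp_neg_gaussianReal {E : Type*} [NormedAddCommGroup E] [NormedSpace ℝ E]
    (f : ℝ → E) : ∫ x, f (-x) ∂(gaussianReal 0 1) = ∫ x, f x ∂(gaussianReal 0 1) := by
  have h : (gaussianReal 0 1).map (fun x : ℝ => -x) = gaussianReal 0 1 := by
    rw [gaussianReal_map_neg, neg_zero]
  conv_rhs => rw [← h]
  exact ((MeasurableEquiv.neg ℝ).measurableEmbedding.integral_map f).symm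

lemma integral_prod_scaledHermite_of_odd {s : Multiset ℕ} (hs : Odd s.sum) :
    ∫ x, ((s.map scaledHermite).prod).eval x ∂(gaussianReal 0 1) = 0 := by
  have h := integral_comp_neg_gaussianReal fun x => ((s.map scaledHermite).prod).eval x
  simp only [eval_neg_prod_scaledHermite, hs.neg_one_pow, neg_mul, one_mul, integral_neg] at h
  linarith

end GaussianPolynomials

/-! ### Hermite expansion of the Mehler kernel. -/

section MehlerKernel

open Polynomial Complex

/-- The density of the normal law with mean `y` and variance `1 - θ` with respect to the standard
normal law. -/
noncomputable def mehlerKernel (θ y x : ℝ) : ℝ :=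
  (√(1 - θ))⁻¹ * Real.exp (x ^ 2 / 2 - (x - y) ^ 2 / (2 * (1 - θ)))

/-- The generating function `w ↦ exp (x w - w² / 2)` of the Hermite polynomials. -/
noncomputable def hermiteExp (x : ℝ) (w : ℂ) : ℂ := cexp (x * w - w ^ 2 / 2)

lemma hermiteExp_gaussian_eq (θ y x u : ℝ) (hθ : 0 ≤ θ) :
    gaussianPDFReal 0 1 u • hermiteExp x (y + I * (√θ * u : ℝ)) =
      ((√(2 * Real.pi))⁻¹ : ℝ) * cexp (((θ - 1) / 2 : ℂ) * u ^ 2 + (I * √θ * (x - y)) * u +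
        (x * y - y ^ 2 / 2)) := by
  have h : (√θ : ℂ) ^ 2 = θ := by
    rw [← ofReal_pow, Real.sq_sqrt hθ]
  rw [gaussianPDFReal_zero_one, hermiteExp, real_smul, ofReal_mul, mul_assoc, ofReal_exp,
    ← Complex.exp_add]
  congr 2
  push_cast
  linear_combination (-(1 / 2 : ℂ) * I ^ 2 * u ^ 2) * h - (1 / 2 : ℂ) * θ * u ^ 2 * I_sq

lemma integrable_hermiteExp {θ : ℝ} (hθ : 0 ≤ θ) (hθ1 : θ < 1) (y x : ℝ) :
    Integrable (fun u : ℝ => hermiteExp x (y + I * (√θ * u : ℝ))) (gaussianReal 0 1) := by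
  rw [integrable_gaussianReal_iff]
  simp only [hermiteExp_gaussian_eq _ _ _ _ hθ]
  refine (integrable_cexp_quadratic' ?_ _ _).const_mul _
  have : ((θ - 1) / 2 : ℂ) = ((θ - 1) / 2 : ℝ) := by push_cast; ring
  rw [this, ofReal_re]
  linarith

/-- `hermiteExp · w` is the density of a normal law with mean `w` and variance 1. An imaginary
Gaussian shift of the mean, with variance `θ`, subtracts `θ` from that variance. -/
lemma mehlerKernel_eq_integral {θ : ℝ} (hθ : 0 ≤ θ) (hθ1 : θ < 1) (y x : ℝ) :
    (mehlerKernel θ y x : ℂ) =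
      ∫ u, hermiteExp x (y + I * (√θ * u : ℝ)) ∂(gaussianReal 0 1) := by
  rw [integral_gaussianReal_eq_integral_smul one_ne_zero]
  simp only [hermiteExp_gaussian_eq _ _ _ _ hθ]
  have hb : ((θ - 1) / 2 : ℂ) = ((θ - 1) / 2 : ℝ) := by push_cast; ring
  have hsq : (√θ : ℂ) ^ 2 = θ := by
    rw [← ofReal_pow, Real.sq_sqrt hθ]
  have h1 : (1 - θ : ℂ) ≠ 0 := by
    have : (1 - θ : ℂ) = ((1 - θ : ℝ) : ℂ) := by push_cast; ring
    rw [this]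
    exact_mod_cast (by linarith : (1 - θ : ℝ) ≠ 0)
  have h2 : (θ - 1 : ℂ) ≠ 0 := by
    rw [← neg_sub]
    exact neg_ne_zero.2 h1
  rw [integral_const_mul, integral_cexp_quadratic (by rw [hb, ofReal_re]; linarith)]
  have hroot : ((Real.pi : ℂ) / -((θ - 1) / 2)) ^ (1 / 2 : ℂ) =
      ((√(2 * Real.pi) * (√(1 - θ))⁻¹ : ℝ) : ℂ) := by
    have : ((Real.pi : ℂ) / -((θ - 1) / 2)) = ((2 * Real.pi / (1 - θ) : ℝ) : ℂ) := by
      push_cast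
      field_simp
      ring
    rw [this, ← div_eq_mul_inv, ← Real.sqrt_div (by positivity), Real.sqrt_eq_rpow,
      ofReal_cpow (div_nonneg (by positivity) (by linarith))]
    norm_num
  rw [hroot, mehlerKernel, ← mul_assoc, ← ofReal_mul, ← mul_assoc, inv_mul_cancel₀ (by positivity),
    one_mul, ofReal_mul, ofReal_exp]
  congr 2
  push_cast
  field_simp
  linear_combination (4 * (1 - θ : ℂ) * I ^ 2 * (x - y) ^ 2) * hsq + 4 * (1 - θ : ℂ) * θ * (x - y) ^ 2 * I_sq

lemma differentiable_hermiteExp (x : ℝ) : Differentiable ℂ (hermiteExp x) := by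
  unfold hermiteExp
  fun_prop

lemma iteratedDeriv_hermiteExp (x : ℝ) (k : ℕ) (w : ℂ) :
    iteratedDeriv k (hermiteExp x) w = aeval (x - w : ℂ) (hermite k) * hermiteExp x w := by
  induction k generalizing w with
  | zero => simp
  | succ k ih =>
    rw [iteratedDeriv_succ, funext ih]
    have h1 : HasDerivAt (fun w : ℂ => aeval (x - w : ℂ) (hermite k))
        (aeval (x - w : ℂ) (derivative (hermite k)) * (-1)) w := by
      have := ((hermite k).hasDerivAt_aeval (x - w : ℂ)).comp w
        ((hasDerivAt_id w).const_sub (x : ℂ))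
      simpa using! this
    have h2 : HasDerivAt (hermiteExp x) (hermiteExp x w * (x - w)) w := by
      have : HasDerivAt (fun w : ℂ => (x : ℂ) * w - w ^ 2 / 2) ((x : ℂ) - w) w := by
        have := ((hasDerivAt_id w).const_mul (x : ℂ)).sub ((hasDerivAt_pow 2 w).div_const 2)
        convert! this using 1
        simp
      exact this.cexp
    have h3 := (h1.mul h2).deriv
    rw [Pi.mul_def] at h3
    rw [h3, hermite_succ, map_sub, map_mul, aeval_X]
    ring

lemma hasSum_hermiteExp (x : ℝ) (w : ℂ) :
    HasSum (fun k => (((scaledHermite k).eval x : ℝ) : ℂ) * w ^ k) (hermiteExp x w) := by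
  refine (hasSum_taylorSeries_of_entire (differentiable_hermiteExp x) 0 w).congr_fun ?_
  intro k
  rw [iteratedDeriv_hermiteExp]
  have h : aeval (x - 0 : ℂ) (hermite k) = ((((hermite k).map (Int.castRingHom ℝ)).eval x : ℝ) : ℂ) := by
    rw [sub_zero, ← Complex.coe_algebraMap, aeval_algebraMap_apply, aeval_def, eval_map]
    rfl
  rw [h]
  simp [scaledHermite, hermiteExp]
  ring

lemma norm_hermiteExp_le (x : ℝ) (w : ℂ) :
    ‖hermiteExp x w‖ ≤ Real.exp (|x| * ‖w‖ + ‖w‖ ^ 2 / 2) := by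
  refine (norm_exp_le_exp_norm _).trans (Real.exp_le_exp.2 ?_)
  refine (norm_sub_le _ _).trans ?_
  simp

/-- Cauchy's estimate for the entire function `hermiteExp x` on the circle of radius `R`. -/
lemma norm_scaledHermite_mul_pow_le (x : ℝ) (w : ℂ) {R : ℝ} (hR : 0 < R) (k : ℕ) :
    ‖(((scaledHermite k).eval x : ℝ) : ℂ) * w ^ k‖ ≤
      Real.exp (|x| * R + R ^ 2 / 2) * (‖w‖ / R) ^ k := by
  have h1 : ‖iteratedDeriv k (hermiteExp x) 0‖ ≤
      k ! * Real.exp (|x| * R + R ^ 2 / 2) / R ^ k := by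
    refine norm_iteratedDeriv_le_of_forall_mem_sphere_norm_le k hR
      (differentiable_hermiteExp x).diffContOnCl fun z hz => ?_
    have := norm_hermiteExp_le x z
    rwa [mem_sphere_zero_iff_norm.1 hz] at this
  rw [iteratedDeriv_hermiteExp] at h1
  have h : aeval (x - 0 : ℂ) (hermite k) = ((((hermite k).map (Int.castRingHom ℝ)).eval x : ℝ) : ℂ) := by
    rw [sub_zero, ← Complex.coe_algebraMap, aeval_algebraMap_apply, aeval_def, eval_map]
    rfl
  rw [h] at h1
  simp only [hermiteExp, mul_zero, ne_eq, OfNat.ofNat_ne_zero, not_false_eq_true, zero_pow,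
    zero_div, sub_self, Complex.exp_zero, mul_one, norm_real] at h1
  rw [scaledHermite, eval_mul, eval_C, ofReal_mul, norm_mul, norm_mul, norm_pow, div_pow,
    norm_real, norm_real, norm_inv, RCLike.norm_natCast]
  rw [le_div_iff₀ (by positivity)] at h1
  have hk : (0 : ℝ) < k ! := by positivity
  rw [mul_assoc, inv_mul_le_iff₀ hk, ← mul_div_assoc, ← mul_div_assoc, le_div_iff₀ (by positivity)]
  nlinarith [mul_le_mul_of_nonneg_right h1 (by positivity : 0 ≤ ‖w‖ ^ k)]

lemma norm_hermiteExp_sub_sum_le (x : ℝ) (w : ℂ) (n : ℕ) :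
    ‖hermiteExp x w - ∑ k ∈ Finset.range (n + 1), (((scaledHermite k).eval x : ℝ) : ℂ) * w ^ k‖ ≤
      2 * Real.exp (|x| * (2 * ‖w‖ + 1) + (2 * ‖w‖ + 1) ^ 2 / 2) * ‖w‖ ^ (n + 1) := by
  have hs := (hasSum_nat_add_iff' (n + 1)).2 (hasSum_hermiteExp x w)
  -- This radius makes the ratio `‖w‖ / R` at most both `1/2`, so the tail is geometric, and `‖w‖`,
  -- so the factor `‖w‖ ^ (n + 1)` comes out.
  set R : ℝ := 2 * ‖w‖ + 1 with hR
  have hw := norm_nonneg w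
  have hR1 : 1 ≤ R := by linarith
  set E := Real.exp (|x| * R + R ^ 2 / 2)
  have hg : HasSum (fun i : ℕ => E * ‖w‖ ^ (n + 1) * (1 / 2 : ℝ) ^ i)
      (E * ‖w‖ ^ (n + 1) * 2) := hasSum_geometric_two.mul_left _
  refine (hs.norm_le_of_bounded hg fun i => ?_).trans (by linarith)
  refine (norm_scaledHermite_mul_pow_le x w (by linarith : 0 < R) _).trans ?_
  have h1 : ‖w‖ / R ≤ ‖w‖ := div_le_self hw hR1
  have h2 : ‖w‖ / R ≤ 1 / 2 := by
    rw [div_le_iff₀ (by linarith)]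
    linarith
  rw [mul_assoc, pow_add, mul_comm ((‖w‖ / R) ^ i)]
  gcongr

/-- The polynomial `z ↦ E (z + i √v G) ^ k` with `G` standard normal. -/
noncomputable def gaussianShiftMoment (v : ℝ) (k : ℕ) (z : ℝ) : ℂ :=
  ∫ u, (z + I * (√v * u : ℝ) : ℂ) ^ k ∂(gaussianReal 0 1)

lemma norm_add_I_mul_le {v : ℝ} (hv : 0 ≤ v) (z u : ℝ) :
    ‖(z + I * (√v * u : ℝ) : ℂ)‖ ≤ (1 + |z|) * (1 + v + u ^ 2) := by
  have h1 : ‖(z + I * (√v * u : ℝ) : ℂ)‖ ≤ |z| + √v * |u| := by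
    refine (norm_add_le _ _).trans ?_
    rw [norm_mul, norm_I, one_mul, norm_real, norm_real, Real.norm_eq_abs, Real.norm_eq_abs,
      abs_mul, abs_of_nonneg (Real.sqrt_nonneg v)]
  have h2 : √v * |u| ≤ v + u ^ 2 := by
    have := Real.sq_sqrt hv
    nlinarith [sq_nonneg (√v - |u|), sq_abs u, sq_nonneg u]
  nlinarith [abs_nonneg z, sq_nonneg u]

lemma exists_pow_le_exp_sq (v : ℝ) (k : ℕ) :
    ∃ C : ℝ, 0 ≤ C ∧ ∀ u : ℝ, (1 + v + u ^ 2) ^ k ≤ C * Real.exp (1 / 8 * u ^ 2) := by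
  obtain ⟨C, hC, h⟩ := exists_abs_eval_le_exp_sq ((C (1 + v) + X ^ 2 : ℝ[X]) ^ k)
    (δ := 1 / 8) (by norm_num)
  refine ⟨C, hC, fun u => (le_abs_self _).trans ?_⟩
  simpa using h u

lemma integrable_gaussianShiftMoment {v : ℝ} (hv : 0 ≤ v) (k : ℕ) (z : ℝ) :
    Integrable (fun u : ℝ => (z + I * (√v * u : ℝ) : ℂ) ^ k) (gaussianReal 0 1) := by
  obtain ⟨C, hC, h⟩ := exists_pow_le_exp_sq v k
  refine ((integrable_exp_mul_sq (c := 1 / 8) (by norm_num)).const_mul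
    ((1 + |z|) ^ k * C)).mono' (by fun_prop) (ae_of_all _ fun u => ?_)
  rw [norm_pow]
  calc _ ≤ ((1 + |z|) * (1 + v + u ^ 2)) ^ k := by gcongr; exact norm_add_I_mul_le hv z u
    _ ≤ _ := by
      rw [mul_pow, mul_assoc]
      gcongr
      exact h u

lemma exists_norm_gaussianShiftMoment_le {v : ℝ} (hv : 0 ≤ v) (k : ℕ) :
    ∃ C : ℝ, 0 ≤ C ∧ ∀ z : ℝ, ‖gaussianShiftMoment v k z‖ ≤ C * (1 + |z|) ^ k := by
  obtain ⟨C, hC, h⟩ := exists_pow_le_exp_sq v k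
  refine ⟨C * ∫ u, Real.exp (1 / 8 * u ^ 2) ∂(gaussianReal 0 1),
    mul_nonneg hC (integral_nonneg fun _ => (Real.exp_pos _).le), fun z => ?_⟩
  have hi := (integrable_exp_mul_sq (c := 1 / 8) (by norm_num)).const_mul ((1 + |z|) ^ k * C)
  refine (norm_integral_le_of_norm_le hi (ae_of_all _ fun u => ?_)).trans ?_
  · rw [norm_pow]
    calc _ ≤ ((1 + |z|) * (1 + v + u ^ 2)) ^ k := by gcongr; exact norm_add_I_mul_le hv z u
      _ ≤ _ := by
        rw [mul_pow, mul_assoc]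
        gcongr
        exact h u
  · rw [integral_const_mul]
    apply le_of_eq
    ring

/-- Here `t` is `ε √v` and `r` the size of the complex argument. The cross term `2t|x||u|` is split
by the inequality of the means. The bound `t ≤ δ/2` leaves the weight `δ` in `x`, and `5t ≤ 1/8`
leaves the weight `1/8` in `u`. -/
lemma exp_remainder_le {δ t x u r : ℝ} (hδ : 0 < δ) (ht : 0 ≤ t) (htδ : t ≤ δ / 2)
    (ht1 : t ≤ 1 / 40) (hr0 : 0 ≤ r) (hr : r ≤ 1 + t * |u|) :
    Real.exp (|x| * (2 * r + 1) + (2 * r + 1) ^ 2 / 2) ≤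
      Real.exp (9 + 9 / (2 * δ)) * Real.exp (δ * x ^ 2) * Real.exp (1 / 8 * u ^ 2) := by
  rw [← Real.exp_add, ← Real.exp_add]
  apply Real.exp_le_exp.2
  have hu := abs_nonneg u
  have hx := abs_nonneg x
  have h1 : |x| * (2 * r + 1) ≤ 3 * |x| + t * (x ^ 2 + u ^ 2) := by
    have : |x| * (2 * r + 1) ≤ |x| * (3 + 2 * (t * |u|)) :=
      mul_le_mul_of_nonneg_left (by linarith) hx
    have h3 : 0 ≤ t * (|x| - |u|) ^ 2 := by positivity
    have h4 : t * (|x| - |u|) ^ 2 = t * (x ^ 2 + u ^ 2) - 2 * t * |x| * |u| := by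
      rw [← sq_abs x, ← sq_abs u]; ring
    nlinarith
  have h2 : (2 * r + 1) ^ 2 / 2 ≤ 9 + 4 * (t * u ^ 2) := by
    have : (2 * r + 1) ^ 2 ≤ (3 + 2 * (t * |u|)) ^ 2 :=
      pow_le_pow_left₀ (by linarith) (by linarith) 2
    have h3 : (t * |u|) ^ 2 ≤ t * u ^ 2 := by
      rw [mul_pow, sq_abs]
      gcongr
      nlinarith
    nlinarith [sq_nonneg (3 - 2 * (t * |u|))]
  have h3 : 3 * |x| ≤ 9 / (2 * δ) + δ / 2 * x ^ 2 := by
    have h : 0 ≤ δ / 2 * (|x| - 3 / δ) ^ 2 := by positivity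
    have h' : δ / 2 * (|x| - 3 / δ) ^ 2 = δ / 2 * x ^ 2 - 3 * |x| + 9 / (2 * δ) := by
      rw [← sq_abs x]
      field_simp
      ring
    linarith
  have h4 : t * x ^ 2 ≤ δ / 2 * x ^ 2 := by gcongr
  have h5 : t * u ^ 2 ≤ 1 / 40 * u ^ 2 := by gcongr
  nlinarith

/-- The Hermite expansion of the Mehler kernel, with a remainder bound. -/
lemma exists_mehlerKernel_expansion {v : ℝ} (hv : 0 ≤ v) (n : ℕ) {δ : ℝ} (hδ : 0 < δ) :
    ∃ C : ℝ, 0 ≤ C ∧ ∃ ε₀ : ℝ, 0 < ε₀ ∧ ∀ ε : ℝ, 0 < ε → ε ≤ ε₀ → ∀ z x : ℝ, |ε * z| ≤ 1 →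
      ‖(mehlerKernel (v * ε ^ 2) (ε * z) x : ℂ) - ∑ k ∈ Finset.range (n + 1),
          (((scaledHermite k).eval x : ℝ) : ℂ) * (ε ^ k * gaussianShiftMoment v k z)‖ ≤
        C * ε ^ (n + 1) * (1 + |z|) ^ (n + 1) * Real.exp (δ * x ^ 2) := by
  obtain ⟨C, hC, hp⟩ := exists_pow_le_exp_sq v (n + 1)
  -- The exponent `1/4` is `1/8` from the polynomial factor plus `1/8` from `exp_remainder_le`.
  set J := ∫ u, Real.exp (1 / 4 * u ^ 2) ∂(gaussianReal 0 1)
  set D := Real.exp (9 + 9 / (2 * δ))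
  set m := min (δ / 2) (1 / 40) with hm
  have hm0 : 0 < m := lt_min (by linarith) (by norm_num)
  -- The threshold ensures `ε √v ≤ m`; the added one covers `v = 0`.
  refine ⟨2 * D * C * J, ?_, m / (√v + 1), by positivity, fun ε hε hεm z x hz => ?_⟩
  · have : 0 ≤ J := integral_nonneg fun _ => (Real.exp_pos _).le
    positivity
  have ht : ε * √v ≤ m := by
    rw [le_div_iff₀ (by positivity)] at hεm
    nlinarith
  have ht0 : 0 ≤ ε * √v := by positivity
  have hsqrt : √(v * ε ^ 2) = ε * √v := by
    rw [Real.sqrt_mul hv, Real.sqrt_sq hε.le, mul_comm]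
  have hθ1 : v * ε ^ 2 < 1 := by
    have : v * ε ^ 2 = (ε * √v) ^ 2 := by rw [mul_pow, Real.sq_sqrt hv]; ring
    rw [this]
    have : ε * √v ≤ 1 / 40 := ht.trans (min_le_right _ _)
    nlinarith
  have hw : ∀ u : ℝ, ((ε * z : ℝ) + I * (√(v * ε ^ 2) * u : ℝ) : ℂ) =
      ε * (z + I * (√v * u : ℝ)) := by
    intro u
    rw [hsqrt]
    push_cast
    ring
  rw [mehlerKernel_eq_integral (by positivity) hθ1]
  have hi1 := integrable_hermiteExp (by positivity : 0 ≤ v * ε ^ 2) hθ1 (ε * z) x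
  have hi2 : ∀ k ∈ Finset.range (n + 1), Integrable (fun u : ℝ =>
      (((scaledHermite k).eval x : ℝ) : ℂ) * (ε ^ k * (z + I * (√v * u : ℝ) : ℂ) ^ k))
      (gaussianReal 0 1) := fun k _ =>
    ((integrable_gaussianShiftMoment hv k z).const_mul _).const_mul _
  have hsum : ∑ k ∈ Finset.range (n + 1),
      (((scaledHermite k).eval x : ℝ) : ℂ) * (ε ^ k * gaussianShiftMoment v k z) =
      ∫ u, ∑ k ∈ Finset.range (n + 1),
        (((scaledHermite k).eval x : ℝ) : ℂ) * (ε ^ k * (z + I * (√v * u : ℝ) : ℂ) ^ k)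
        ∂(gaussianReal 0 1) := by
    rw [integral_finsetSum _ hi2]
    refine Finset.sum_congr rfl fun k _ => ?_
    rw [integral_const_mul, integral_const_mul, gaussianShiftMoment]
  rw [hsum, ← integral_sub hi1 (integrable_finsetSum _ hi2)]
  have hi := (integrable_exp_mul_sq (c := 1 / 4) (by norm_num)).const_mul
    (2 * D * C * ε ^ (n + 1) * (1 + |z|) ^ (n + 1) * Real.exp (δ * x ^ 2))
  refine (norm_integral_le_of_norm_le hi (ae_of_all _ fun u => ?_)).trans ?_
  · rw [hw u]
    simp only [← mul_pow]
    set w : ℂ := ε * (z + I * (√v * u : ℝ)) with hwdef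
    refine (norm_hermiteExp_sub_sum_le x w n).trans ?_
    have hnw : ‖w‖ = ε * ‖(z + I * (√v * u : ℝ) : ℂ)‖ := by
      rw [hwdef, norm_mul, norm_real, Real.norm_eq_abs, abs_of_pos hε]
    have h1 : ‖w‖ ≤ 1 + ε * √v * |u| := by
      rw [hnw]
      calc _ ≤ ε * (|z| + √v * |u|) := by
            gcongr
            refine (norm_add_le _ _).trans ?_
            rw [norm_mul, norm_I, one_mul, norm_real, norm_real, Real.norm_eq_abs,
              Real.norm_eq_abs, abs_mul, abs_of_nonneg (Real.sqrt_nonneg v)]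
        _ = |ε * z| + ε * √v * |u| := by
            rw [abs_mul, abs_of_pos hε]; ring
        _ ≤ _ := by linarith
    have h2 := exp_remainder_le (x := x) hδ ht0 (ht.trans (min_le_left _ _))
      (ht.trans (min_le_right _ _)) (norm_nonneg w) h1
    have h3 : ‖w‖ ^ (n + 1) ≤
        ε ^ (n + 1) * ((1 + |z|) ^ (n + 1) * (C * Real.exp (1 / 8 * u ^ 2))) := by
      rw [hnw, mul_pow]
      gcongr
      calc _ ≤ ((1 + |z|) * (1 + v + u ^ 2)) ^ (n + 1) := by
            gcongr; exact norm_add_I_mul_le hv z u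
        _ ≤ _ := by
          rw [mul_pow]
          gcongr
          exact hp u
    have h4 : Real.exp (1 / 4 * u ^ 2) = Real.exp (1 / 8 * u ^ 2) * Real.exp (1 / 8 * u ^ 2) := by
      rw [← Real.exp_add]; congr 1; ring
    calc _ ≤ 2 * (D * Real.exp (δ * x ^ 2) * Real.exp (1 / 8 * u ^ 2)) *
          (ε ^ (n + 1) * ((1 + |z|) ^ (n + 1) * (C * Real.exp (1 / 8 * u ^ 2)))) := by
          gcongr
      _ = _ := by
          rw [h4]
          ring
  · rw [integral_const_mul]
    apply le_of_eq
    ring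

end MehlerKernel

/-! ### Cumulants, modified moments and the characteristic function. -/

section Cumulants

open Complex Topology

/-- The principal logarithm is additive here only while the imaginary part of the right-hand side
stays in `(-π, π)`. By continuity this holds near `0`, where that side vanishes. -/
lemma eventually_log_charFun_eq {μ₁ μ₂ : Measure ℝ} [IsProbabilityMeasure μ₁]
    [IsProbabilityMeasure μ₂] (a b : ℂ)
    (h : ∀ t : ℝ, charFun μ₁ t = charFun μ₂ t * cexp (a * t + b * t ^ 2)) :
    ∀ᶠ t : ℝ in 𝓝 0, log (charFun μ₁ t) = log (charFun μ₂ t) + (a * t + b * t ^ 2) := by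
  have hc : ContinuousAt (fun t : ℝ => log (charFun μ₂ t) + (a * t + b * t ^ 2)) 0 := by
    refine ContinuousAt.add (ContinuousAt.clog continuous_charFun.continuousAt ?_) (by fun_prop)
    simp [slitPlane]
  have h0 : log (charFun μ₂ (0 : ℝ)) + (a * (0 : ℝ) + b * (0 : ℝ) ^ 2) = 0 := by simp
  have him : ContinuousAt (fun t : ℝ => (log (charFun μ₂ t) + (a * t + b * t ^ 2)).im) 0 :=
    continuous_im.continuousAt.comp hc
  have h1 : ∀ᶠ t : ℝ in 𝓝 0, (log (charFun μ₂ t) + (a * t + b * t ^ 2)).im ∈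
      Set.Ioo (-Real.pi) Real.pi := by
    refine him.eventually_mem (Ioo_mem_nhds ?_ ?_) <;> rw [h0] <;> simp [Real.pi_pos]
  have h2 : ∀ᶠ t : ℝ in 𝓝 0, charFun μ₂ t ≠ 0 :=
    continuous_charFun.continuousAt.eventually_ne (by simp)
  filter_upwards [h1, h2] with t ht ht2
  rw [h t, ← log_exp ht.1 ht.2.le, Complex.exp_add (log _), exp_log ht2]

lemma contDiffAt_log_charFun {μ : Measure ℝ} [IsProbabilityMeasure μ] {n : ℕ}
    (hint : MemLp id n μ) : ContDiffAt ℝ n (fun t : ℝ => log (charFun μ t)) 0 := by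
  refine ((contDiffAt_log (n := n) ?_).restrict_scalars ℝ).comp (0 : ℝ)
    (contDiff_charFun hint).contDiffAt
  simp [slitPlane]

lemma iteratedDeriv_quadratic_eq_zero (a b : ℂ) {k : ℕ} (hk : 3 ≤ k) :
    iteratedDeriv k (fun t : ℝ => a * t + b * t ^ 2) 0 = 0 := by
  obtain ⟨m, rfl⟩ := Nat.exists_eq_add_of_le' hk
  have hid : ∀ t : ℝ, HasDerivAt (fun t : ℝ => (t : ℂ)) 1 t := fun t => by
    simpa using (hasDerivAt_id t).ofReal_comp
  have h1 : deriv (fun t : ℝ => a * t + b * t ^ 2) = fun t : ℝ => a + 2 * b * t := by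
    ext t
    refine HasDerivAt.deriv ?_
    have := ((hid t).const_mul a).add (((hid t).pow 2).const_mul b)
    convert! this using 1
    simp
    ring
  have h2 : deriv (fun t : ℝ => a + 2 * b * t) = fun _ => 2 * b := by
    ext t
    refine HasDerivAt.deriv ?_
    simpa using ((hid t).const_mul (2 * b)).const_add a
  rw [iteratedDeriv_succ', h1, iteratedDeriv_succ', h2, iteratedDeriv_succ', deriv_const']
  simp

lemma iteratedDeriv_log_charFun_eq {μ₁ μ₂ : Measure ℝ} [IsProbabilityMeasure μ₁]
    [IsProbabilityMeasure μ₂] {a b : ℂ} {k : ℕ} (hk : 3 ≤ k) (hint : MemLp id k μ₂)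
    (h : ∀ t : ℝ, charFun μ₁ t = charFun μ₂ t * cexp (a * t + b * t ^ 2)) :
    iteratedDeriv k (fun t : ℝ => log (charFun μ₁ t)) 0 =
      iteratedDeriv k (fun t : ℝ => log (charFun μ₂ t)) 0 := by
  have hof : ContDiff ℝ k (fun t : ℝ => (t : ℂ)) := ofRealCLM.contDiff
  rw [Filter.EventuallyEq.iteratedDeriv_eq k (eventually_log_charFun_eq a b h),
    iteratedDeriv_fun_add (contDiffAt_log_charFun hint) (by fun_prop),
    iteratedDeriv_quadratic_eq_zero a b hk, add_zero]

lemma cumulant_eq_of_charFun_eq {Ω Ω' : Type*} [MeasurableSpace Ω] [MeasurableSpace Ω']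
    {P : Measure Ω} {P' : Measure Ω'} [IsProbabilityMeasure P] [IsProbabilityMeasure P']
    {X : Ω → ℝ} {X' : Ω' → ℝ} (hX : AEMeasurable X P) {k : ℕ} (hk : 3 ≤ k)
    (hX' : MemLp X' k P') {a b : ℂ}
    (h : ∀ t : ℝ, charFun (P.map X) t = charFun (P'.map X') t * cexp (a * t + b * t ^ 2)) :
    cumulant X P k = cumulant X' P' k := by
  have := Measure.isProbabilityMeasure_map hX
  have := Measure.isProbabilityMeasure_map hX'.aemeasurable
  rw [cumulant, cumulant, iteratedDeriv_log_charFun_eq hk _ h]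
  rw [memLp_map_measure_iff (by fun_prop) hX'.aemeasurable]
  simpa using hX'

lemma modifiedMoment_congr {κ κ' : ℕ → ℝ} {k : ℕ}
    (h : ∀ j, 3 ≤ j → j ≤ k → κ j = κ' j) : modifiedMoment κ k = modifiedMoment κ' k := by
  induction k using Nat.strong_induction_on with
  | _ k ih =>
    rcases lt_or_ge k 3 with hk | hk
    · interval_cases k <;> simp [modifiedMoment_zero, modifiedMoment_one, modifiedMoment_two]
    · rw [modifiedMoment_of_three_le κ hk, modifiedMoment_of_three_le κ' hk, h k hk le_rfl]
      congr 1
      refine Finset.sum_congr rfl fun j hj => ?_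
      rw [Finset.mem_Icc] at hj
      rw [ih j (by omega) fun i hi hij => h i hi (by omega), h (k - j) (by omega) (by omega)]

lemma iteratedDeriv_ofReal_comp {f : ℝ → ℝ} (hf : ContDiff ℝ ⊤ f) (k : ℕ) (t : ℝ) :
    iteratedDeriv k (fun t => (f t : ℂ)) t = (iteratedDeriv k f t : ℝ) := by
  induction k generalizing t with
  | zero => simp
  | succ k ih =>
    rw [iteratedDeriv_succ, funext ih, iteratedDeriv_succ]
    have : DifferentiableAt ℝ (iteratedDeriv k f) t :=
      (hf.differentiable_iteratedDeriv k (by exact_mod_cast WithTop.coe_lt_top _)) t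
    exact this.hasDerivAt.ofReal_comp.deriv

/-- `exp (v t² / 2)` is the moment generating function of `-√v G`, and `-√v G = i · (i √v G)`. -/
lemma iteratedDeriv_exp_sq {v : ℝ} (hv : 0 ≤ v) (k : ℕ) :
    iteratedDeriv k (fun t : ℝ => cexp (v * t ^ 2 / 2)) 0 =
      I ^ k * ∫ u, (I * (√v * u : ℝ) : ℂ) ^ k ∂(gaussianReal 0 1) := by
  have hlaw : (gaussianReal 0 1).map (fun u : ℝ => -√v * u) =
      gaussianReal 0 v.toNNReal := by
    rw [gaussianReal_map_const_mul]
    congr 1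
    · simp
    · ext
      simp [Real.sq_sqrt hv, hv]
  have hmgf : mgf (fun u : ℝ => -√v * u) (gaussianReal 0 1) = fun t => Real.exp (v * t ^ 2 / 2) := by
    ext t
    rw [mgf_gaussianReal hlaw]
    simp [hv]
  have h1 := iteratedDeriv_mgf_zero (X := fun u : ℝ => -√v * u) (μ := gaussianReal 0 1) (by
    have : integrableExpSet (fun u : ℝ => -√v * u) (gaussianReal 0 1) = Set.univ := by
      ext t
      simp only [integrableExpSet, Set.mem_ofPred_eq, Set.mem_univ, iff_true]
      simpa [mul_assoc] using integrable_exp_mul_gaussianReal (μ := 0) (v := 1) (t * -√v)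
    rw [this, interior_univ]
    trivial) k
  rw [hmgf] at h1
  have h2 := iteratedDeriv_ofReal_comp (f := fun t => Real.exp (v * t ^ 2 / 2)) (by fun_prop) k 0
  rw [h1] at h2
  have h3 : (fun t : ℝ => cexp (v * t ^ 2 / 2)) =
      fun t : ℝ => ((Real.exp (v * t ^ 2 / 2) : ℝ) : ℂ) := by
    ext t; push_cast; rfl
  rw [h3, h2, ← integral_complex_ofReal, ← integral_const_mul]
  congr 1
  ext u
  simp only [Pi.pow_apply]
  push_cast
  rw [← mul_pow, ← mul_assoc, I_mul_I]
  ring_nf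

variable {ρ : Measure ℝ} [IsProbabilityMeasure ρ]

lemma integrable_ofReal_pow {n k : ℕ} (hint : MemLp id n ρ) (hk : k ≤ n) :
    Integrable (fun z : ℝ => (z : ℂ) ^ k) ρ := by
  have h1 : MemLp id k ρ := hint.mono_exponent (by exact_mod_cast hk)
  have h2 := h1.integrable_norm_pow'
  refine h2.mono (by fun_prop) (ae_of_all _ fun z => ?_)
  simp

/-- The derivatives at `0` of the characteristic function multiplied by `exp (v t² / 2)`. -/
lemma iteratedDeriv_charFun_mul_exp {n k : ℕ} (hint : MemLp id n ρ) (hk : k ≤ n) {v : ℝ}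
    (hv : 0 ≤ v) :
    iteratedDeriv k (fun t : ℝ => charFun ρ t * cexp (v * t ^ 2 / 2)) 0 =
      I ^ k * ∫ z, gaussianShiftMoment v k z ∂ρ := by
  have hint' : ∀ i ≤ n, MemLp id i ρ := fun i hi => hint.mono_exponent (by exact_mod_cast hi)
  have hof : ContDiff ℝ k (fun t : ℝ => (t : ℂ)) := ofRealCLM.contDiff
  -- The Leibniz rule on one side matches the binomial expansion of `(z + i √v G)^k` on the other.
  rw [iteratedDeriv_fun_mul (contDiff_charFun (hint' k hk)).contDiffAt (by fun_prop)]
  have hsum : ∀ z : ℝ, gaussianShiftMoment v k z = ∑ i ∈ Finset.range (k + 1),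
      (z : ℂ) ^ i * ((∫ u, (I * (√v * u : ℝ) : ℂ) ^ (k - i) ∂(gaussianReal 0 1)) *
        k.choose i) := by
    intro z
    simp only [gaussianShiftMoment, add_pow]
    rw [integral_finsetSum]
    · refine Finset.sum_congr rfl fun i _ => ?_
      rw [integral_mul_const, integral_const_mul, mul_assoc]
    · intro i _
      refine Integrable.mul_const (Integrable.const_mul ?_ _) _
      simpa using integrable_gaussianShiftMoment hv (k - i) 0
  simp only [hsum]
  rw [integral_finsetSum, Finset.mul_sum]
  · refine Finset.sum_congr rfl fun i hi => ?_
    rw [Finset.mem_range] at hi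
    rw [iteratedDeriv_charFun_zero (hint' i (by omega)), iteratedDeriv_exp_sq hv,
      integral_mul_const]
    have h1 : (I : ℂ) ^ k = I ^ i * I ^ (k - i) := by
      rw [← pow_add]; congr 1; omega
    rw [h1, ← integral_complex_ofReal]
    push_cast
    ring
  · intro i hi
    rw [Finset.mem_range] at hi
    exact (integrable_ofReal_pow hint (by omega)).mul_const _

/-- The symmetry `charFun (-t) = conj (charFun t)` makes `i^(-j)` times the derivative real, so the
real part taken in `cumulant` loses nothing. -/
lemma iteratedDeriv_log_charFun_eq_cumulant (j : ℕ) :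
    iteratedDeriv j (fun t : ℝ => log (charFun ρ t)) 0 = I ^ j * (cumulant id ρ j : ℂ) := by
  have hs : ∀ᶠ t : ℝ in 𝓝 0, charFun ρ t ∈ slitPlane := by
    refine continuous_charFun.continuousAt.eventually_mem (isOpen_slitPlane.mem_nhds ?_)
    simp [slitPlane]
  have h1 : (fun t : ℝ => log (charFun ρ (-t))) =ᶠ[𝓝 0]
      fun t : ℝ => conjCLE (log (charFun ρ t)) := by
    filter_upwards [hs] with t ht
    rw [charFun_neg, conjCLE_apply, log_conj _ (slitPlane_arg_ne_pi ht)]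
  have h2 := h1.iteratedDeriv_eq j
  rw [iteratedDeriv_comp_neg j (fun t : ℝ => log (charFun ρ t)), neg_zero] at h2
  have h3 : iteratedDeriv j (fun t : ℝ => conjCLE (log (charFun ρ t))) 0 =
      conjCLE (iteratedDeriv j (fun t : ℝ => log (charFun ρ t)) 0) := by
    rw [iteratedDeriv, iteratedDeriv]
    have := conjCLE.iteratedFDeriv_comp_left (f := fun t : ℝ => log (charFun ρ t)) (x := 0) (i := j)
    change (iteratedFDeriv ℝ j (conjCLE ∘ fun t : ℝ => log (charFun ρ t)) 0) _ = _
    rw [this]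
    rfl
  rw [h3, conjCLE_apply] at h2
  set L := iteratedDeriv j (fun t : ℝ => log (charFun ρ t)) 0 with hL
  have h4 : (starRingEnd ℂ) ((I ^ j)⁻¹ * L) = (I ^ j)⁻¹ * L := by
    rw [map_mul, ← h2, map_inv₀, map_pow, conj_I, neg_pow, mul_inv, real_smul]
    push_cast
    have : ((-1 : ℂ) ^ j)⁻¹ * (-1) ^ j = 1 := inv_mul_cancel₀ (by simp)
    linear_combination (I ^ j)⁻¹ * L * this
  have h5 : (cumulant id ρ j : ℂ) = (I ^ j)⁻¹ * L := by
    rw [cumulant, Measure.map_id, ← hL]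
    exact conj_eq_iff_re.1 h4
  rw [h5, ← mul_assoc, mul_inv_cancel₀ (by simp), one_mul]

/-- The expectation of the shifted Gaussian moments is the modified moment. -/
theorem integral_gaussianShiftMoment_eq {n k : ℕ} (hn : 2 ≤ n) (hint : MemLp id n ρ)
    (h1 : ∫ z, z ∂ρ = 0) (hk : k ≤ n) :
    ∫ z, gaussianShiftMoment (∫ z, z ^ 2 ∂ρ) k z ∂ρ = (modifiedMoment (cumulant id ρ) k : ℂ) := by
  set v := ∫ z, z ^ 2 ∂ρ with hvdef
  have hv : 0 ≤ v := integral_nonneg fun z => sq_nonneg z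
  have hof : ContDiff ℝ n (fun t : ℝ => (t : ℂ)) := ofRealCLM.contDiff
  set M : ℕ → ℂ := fun k => ∫ z, gaussianShiftMoment v k z ∂ρ with hM
  set Φ : ℝ → ℂ := fun t => charFun ρ t * cexp (v * t ^ 2 / 2) with hΦ
  set L : ℝ → ℂ := fun t => log (charFun ρ t) + (0 * t + (v / 2 : ℂ) * t ^ 2) with hL
  have hΦM : ∀ k ≤ n, iteratedDeriv k Φ 0 = I ^ k * M k := fun k hk =>
    iteratedDeriv_charFun_mul_exp hint hk hv
  have hLn : ContDiffAt ℝ n L 0 := (contDiffAt_log_charFun hint).add (by fun_prop)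
  have hLdiff : ∀ᶠ t in 𝓝 (0 : ℝ), DifferentiableAt ℝ L t := by
    filter_upwards [hLn.eventually (by simp)] with t ht
    exact ht.differentiableAt (by norm_cast; omega)
  have hne : ∀ᶠ t : ℝ in 𝓝 0, charFun ρ t ≠ 0 :=
    continuous_charFun.continuousAt.eventually_ne (by simp)
  have hexp : Φ =ᶠ[𝓝 0] fun t => cexp (L t) := by
    filter_upwards [hne] with t ht
    rw [hL, hΦ, Complex.exp_add, exp_log ht]
    ring_nf
  -- Differentiating this identity `k` times at `0` is the moment-cumulant recursion `hrec`.
  have hderiv : deriv Φ =ᶠ[𝓝 0] fun t => deriv L t * Φ t := by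
    filter_upwards [hexp.eventuallyEq_nhds, hLdiff] with t ht ht2
    rw [ht.deriv_eq, ht2.hasDerivAt.cexp.deriv, ht.eq_of_nhds, mul_comm]
  set l : ℕ → ℂ := fun j => (I ^ j)⁻¹ * iteratedDeriv j L 0 with hl
  have hrec : ∀ k, k + 1 ≤ n → M (k + 1) =
      ∑ i ∈ Finset.range (k + 1), k.choose i * M i * l (k + 1 - i) := by
    intro k hk
    have hd : ContDiffAt ℝ k (deriv L) 0 := by
      have : ContDiffAt ℝ k (fderiv ℝ L) 0 := hLn.fderiv_right (by exact_mod_cast hk)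
      exact this.clm_apply contDiffAt_const
    have hΦk : ContDiffAt ℝ k Φ 0 := by
      refine (ContDiffAt.mul (contDiff_charFun (n := n) hint).contDiffAt
        (by fun_prop)).of_le (by exact_mod_cast (by omega : k ≤ n))
    have h := hΦM (k + 1) hk
    rw [iteratedDeriv_succ', hderiv.iteratedDeriv_eq k] at h
    simp only [mul_comm (deriv L _)] at h
    rw [iteratedDeriv_fun_mul hΦk hd] at h
    have hI : (I : ℂ) ^ (k + 1) ≠ 0 := by simp
    apply mul_left_cancel₀ hI
    rw [← h, Finset.mul_sum]
    refine Finset.sum_congr rfl fun i hi => ?_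
    rw [Finset.mem_range] at hi
    have hIi : (I : ℂ) ^ (k + 1) = I ^ i * I ^ (k + 1 - i) := by
      rw [← pow_add]; congr 1; omega
    rw [hΦM i (by omega), ← iteratedDeriv_succ', hIi, hl]
    have : k - i + 1 = k + 1 - i := by omega
    rw [this]
    have hIj : (I : ℂ) ^ (k + 1 - i) * (I ^ (k + 1 - i))⁻¹ = 1 := mul_inv_cancel₀ (by simp)
    linear_combination (-(k.choose i : ℂ) * I ^ i * M i * iteratedDeriv (k + 1 - i) L 0) * hIj
  have hM0 : M 0 = 1 := by simp [hM, gaussianShiftMoment]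
  have hG1 : ∀ z : ℝ, gaussianShiftMoment v 1 z = z := by
    intro z
    have hi : Integrable (fun u : ℝ => I * ((√v * u : ℝ) : ℂ)) (gaussianReal 0 1) := by
      simpa using integrable_gaussianShiftMoment hv 1 0
    simp only [gaussianShiftMoment, pow_one]
    rw [integral_add (integrable_const _) hi, integral_const_mul,
      integral_complex_ofReal (f := fun u => √v * u), integral_const_mul,
      integral_id_gaussianReal]
    simp
  have hG2 : ∀ z : ℝ, gaussianShiftMoment v 2 z = (z : ℂ) ^ 2 - v := by
    intro z
    have hi : Integrable (fun u : ℝ => I * ((√v * u : ℝ) : ℂ)) (gaussianReal 0 1) := by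
      simpa using integrable_gaussianShiftMoment hv 1 0
    have hi2 : Integrable (fun u : ℝ => u ^ 2) (gaussianReal 0 1) := by
      refine (integrable_eval_gaussianReal (Polynomial.X ^ 2)).congr (ae_of_all _ fun u => ?_)
      simp
    have hvar : ∫ u, u ^ 2 ∂(gaussianReal 0 1) = 1 := by
      have := integral_X_mul_eval_gaussianReal Polynomial.X
      simpa [pow_two] using this
    have he : ∀ u : ℝ, (z + I * (√v * u : ℝ) : ℂ) ^ 2 =
        z ^ 2 + 2 * z * (I * (√v * u : ℝ)) + (-(v * u ^ 2) : ℝ) := by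
      intro u
      have hs : (√v : ℂ) ^ 2 = v := by rw [← ofReal_pow, Real.sq_sqrt hv]
      push_cast
      linear_combination (I ^ 2 * u ^ 2) * hs + (v : ℂ) * u ^ 2 * I_sq
    simp only [gaussianShiftMoment, he]
    rw [integral_add, integral_add (integrable_const _) (hi.const_mul _), integral_const_mul,
      integral_const_mul, integral_complex_ofReal (f := fun u => √v * u),
      integral_complex_ofReal (f := fun u => -(v * u ^ 2)), integral_const_mul,
      integral_id_gaussianReal, integral_neg, integral_const_mul, hvar]
    · simp
      ring
    · exact (integrable_const _).add (hi.const_mul _)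
    · exact (hi2.const_mul v).neg.ofReal
  have hM1 : M 1 = 0 := by
    simp only [hM, hG1]
    rw [integral_complex_ofReal, h1, ofReal_zero]
  have hM2 : M 2 = 0 := by
    simp only [hM, hG2]
    rw [integral_sub (integrable_ofReal_pow hint hn) (integrable_const _)]
    simp only [← ofReal_pow]
    rw [integral_complex_ofReal, ← hvdef]
    simp
  -- The first two cumulants of `Φ` are read off backwards from the recursion, since `M 1 = M 2 =
  -- 0`.
  have hl1 : l 1 = 0 := by
    have := hrec 0 (by omega)
    simpa [hM0, hM1] using this.symm
  have hl2 : l 2 = 0 := by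
    have := hrec 1 (by omega)
    simpa [Finset.sum_range_succ, hM0, hM1, hM2] using this.symm
  have hlj : ∀ j, 3 ≤ j → j ≤ n → l j = (cumulant id ρ j : ℂ) := by
    intro j hj hjn
    have hint' : MemLp id j ρ := hint.mono_exponent (by exact_mod_cast hjn)
    have hofj : ContDiff ℝ j (fun t : ℝ => (t : ℂ)) := ofRealCLM.contDiff
    simp only [hl, hL]
    rw [iteratedDeriv_fun_add (contDiffAt_log_charFun hint') (by fun_prop),
      iteratedDeriv_quadratic_eq_zero _ _ hj, add_zero, iteratedDeriv_log_charFun_eq_cumulant,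
      ← mul_assoc, inv_mul_cancel₀ (by simp), one_mul]
  change M k = _
  induction k using Nat.strong_induction_on with
  | _ k ih =>
    rcases lt_or_ge k 3 with hk3 | hk3
    · interval_cases k
      · simp [hM0, modifiedMoment_zero]
      · simp [hM1, modifiedMoment_one]
      · simp [hM2, modifiedMoment_two]
    · obtain ⟨m, rfl⟩ := Nat.exists_eq_add_of_le' (by omega : 1 ≤ k)
      rw [hrec m hk, modifiedMoment_of_three_le _ hk3, Finset.range_eq_Ico,
        Finset.sum_eq_sum_Ico_succ_bot (by omega), Nat.choose_zero_right, hM0, Nat.sub_zero,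
        hlj _ hk3 hk, Nat.cast_one, one_mul, one_mul, ofReal_add, ofReal_sum]
      congr 1
      symm
      -- The index `0` has already given `κ_k`; the indices dropped at either end contain one of `M
      -- 1`, `M 2`, `l 1`, `l 2`.
      refine Finset.sum_subset_zero_on_sdiff ?_ ?_ ?_
      · intro j hj
        rw [Finset.mem_Icc] at hj
        rw [Finset.mem_Ico]
        omega
      · intro j hj
        rw [Finset.mem_sdiff, Finset.mem_Ico, Finset.mem_Icc] at hj
        obtain h | h | h | h : j = 1 ∨ j = 2 ∨ m + 1 - j = 1 ∨ m + 1 - j = 2 := by omega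
        · rw [h, hM1]; simp
        · rw [h, hM2]; simp
        · rw [h, hl1]; simp
        · rw [h, hl2]; simp
      · intro j hj
        rw [Finset.mem_Icc] at hj
        rw [ih j (by omega) (by omega), hlj _ (by omega) (by omega), Nat.add_sub_cancel]
        push_cast
        rfl

end Cumulants

/-! ### Increments and Taylor approximation of `klFun`. -/

section KLFun

/-- Convexity: the graph lies above its tangent at `a`, whose slope is `log a`. The next lemma uses
the tangent at `a + b`. -/
lemma le_klFun_add_sub {a b : ℝ} (ha : 0 < a) (hb : 0 ≤ b) :
    b * Real.log a ≤ klFun (a + b) - klFun a := by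
  have hab : 0 < a + b := by linarith
  have h := Real.one_sub_inv_le_log_of_pos (div_pos hab ha)
  rw [Real.log_div hab.ne' ha.ne', inv_div] at h
  have h2 := mul_le_mul_of_nonneg_left h hab.le
  have h3 : (a + b) * (1 - a / (a + b)) = b := by
    field_simp
    ring
  rw [h3] at h2
  rw [klFun_apply, klFun_apply]
  nlinarith

lemma klFun_add_sub_le {a b : ℝ} (ha : 0 < a) (hb : 0 ≤ b) :
    klFun (a + b) - klFun a ≤ b * Real.log (a + b) := by
  have hab : 0 < a + b := by linarith
  have h := Real.log_le_sub_one_of_pos (div_pos hab ha)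
  rw [Real.log_div hab.ne' ha.ne'] at h
  have h2 := mul_le_mul_of_nonneg_left h ha.le
  have h3 : a * ((a + b) / a - 1) = b := by
    field_simp
    ring
  rw [h3] at h2
  rw [klFun_apply, klFun_apply]
  nlinarith

lemma abs_klFun_add_sub_le {a b A B : ℝ} (ha : 0 < a) (hb : 0 ≤ b)
    (hA : -A ≤ Real.log a) (hB : Real.log (a + b) ≤ B) (hAB : A ≤ B) :
    |klFun (a + b) - klFun a| ≤ b * B := by
  rw [abs_le]
  have h1 := le_klFun_add_sub ha hb
  have h2 := klFun_add_sub_le ha hb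
  constructor <;> nlinarith

/-- The Taylor polynomial of degree `J` of `u ↦ klFun (1 + u)` at `0`. -/
noncomputable def klTaylor (J : ℕ) (u : ℝ) : ℝ :=
  ∑ j ∈ Finset.Icc 2 J, (-1) ^ j / (j * (j - 1) : ℝ) * u ^ j

lemma klTaylor_succ (J : ℕ) (hJ : 1 ≤ J) (u : ℝ) :
    klTaylor (J + 1) u =
      klTaylor J u + (-1) ^ (J + 1) / ((J + 1) * J : ℝ) * u ^ (J + 1) := by
  rw [klTaylor, Finset.sum_Icc_succ_top (by omega), klTaylor]
  push_cast
  rw [add_sub_cancel_right]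

/-- Relates the series of `log (1 + u)` to that of `klFun (1 + u) = (1 + u) log (1 + u) - u`; the
extra term is of the order of the remainder. -/
lemma one_add_mul_logTaylor (J : ℕ) (hJ : 1 ≤ J) (u : ℝ) :
    (1 + u) * (-∑ i ∈ Finset.range J, (-u) ^ (i + 1) / (i + 1 : ℝ)) - u =
      klTaylor J u + (-1) ^ (J + 1) / (J : ℝ) * u ^ (J + 1) := by
  induction J, hJ using Nat.le_induction with
  | base =>
    simp [klTaylor]
    ring
  | succ J hJ ih =>
    have hJ0 : (J : ℝ) ≠ 0 := by norm_cast; omega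
    have hJ1 : (J + 1 : ℝ) ≠ 0 := by norm_cast
    rw [klTaylor_succ J hJ, Finset.sum_range_succ]
    have h : (1 + u) * (-(∑ i ∈ Finset.range J, (-u) ^ (i + 1) / (i + 1 : ℝ) +
        (-u) ^ (J + 1) / (J + 1 : ℝ))) - u =
        (klTaylor J u + (-1) ^ (J + 1) / (J : ℝ) * u ^ (J + 1)) -
          (1 + u) * ((-u) ^ (J + 1) / (J + 1 : ℝ)) := by
      rw [← ih]
      ring
    rw [h, neg_pow u]
    push_cast
    field_simp
    ring

lemma klFun_le_sq {x : ℝ} (hx : 0 ≤ x) : klFun x ≤ (x - 1) ^ 2 := by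
  rcases hx.eq_or_lt with rfl | hx
  · rw [klFun_zero]; norm_num
  · have := mul_le_mul_of_nonneg_left (Real.log_le_sub_one_of_pos hx) hx.le
    rw [klFun_apply]
    nlinarith

lemma abs_klTaylor_le (J : ℕ) {u : ℝ} (hu : 1 / 2 ≤ |u|) :
    |klTaylor J u| ≤ J * (2 ^ (J + 1) * |u| ^ (J + 1)) := by
  rw [klTaylor]
  refine (Finset.abs_sum_le_sum_abs _ _).trans ?_
  have h1 : ∀ j ∈ Finset.Icc 2 J, |(-1) ^ j / (j * (j - 1) : ℝ) * u ^ j| ≤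
      2 ^ (J + 1) * |u| ^ (J + 1) := by
    intro j hj
    rw [Finset.mem_Icc] at hj
    have h2j : (2 : ℝ) ≤ j := by exact_mod_cast hj.1
    rw [abs_mul, abs_div, abs_pow, abs_pow, abs_neg, abs_one, one_pow, abs_of_pos (by nlinarith)]
    have h2u : 1 ≤ 2 * |u| := by linarith
    calc 1 / (j * (j - 1) : ℝ) * |u| ^ j ≤ 1 * |u| ^ j := by
          gcongr
          rw [div_le_one (by nlinarith)]
          nlinarith
      _ ≤ 1 * (2 * |u|) ^ (J + 1 - j) * |u| ^ j := by
          have := one_le_pow₀ h2u (n := J + 1 - j)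
          nlinarith [pow_nonneg (abs_nonneg u) j]
      _ = 2 ^ (J + 1 - j) * (|u| ^ (J + 1 - j) * |u| ^ j) := by ring
      _ = 2 ^ (J + 1 - j) * |u| ^ (J + 1) := by
          rw [← pow_add]; congr 2; omega
      _ ≤ _ := by
          gcongr
          · norm_num
          · omega
  refine (Finset.sum_le_card_nsmul _ _ _ h1).trans ?_
  rw [nsmul_eq_mul]
  gcongr
  simp

/-- Valid on the whole half-line `u ≥ -1`. For `|u| ≤ 1/2` it is the remainder of the logarithmic
series; for larger `|u|` both terms are separately dominated by `|u|^(J+1)`, because `klFun (1 + u)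
≤ u²`. -/
lemma exists_abs_klFun_sub_klTaylor_le (J : ℕ) (hJ : 1 ≤ J) :
    ∃ C : ℝ, 0 ≤ C ∧ ∀ u : ℝ, -1 ≤ u → |klFun (1 + u) - klTaylor J u| ≤ C * |u| ^ (J + 1) := by
  refine ⟨4 + (2 ^ (J - 1) + J * 2 ^ (J + 1)), by positivity, fun u hu => ?_⟩
  rw [add_mul]
  have hp : 0 ≤ |u| ^ (J + 1) := by positivity
  rcases le_total |u| (1 / 2) with h | h
  · have hlog := Real.abs_log_sub_add_sum_range_le (x := -u) (by rw [abs_neg]; linarith) J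
    rw [abs_neg, sub_neg_eq_add] at hlog
    have hlog2 : |u| ^ (J + 1) / (1 - |u|) ≤ 2 * |u| ^ (J + 1) := by
      rw [div_le_iff₀ (by linarith)]
      nlinarith
    have hT := one_add_mul_logTaylor J hJ u
    have heq : klFun (1 + u) - klTaylor J u =
        (1 + u) * (∑ i ∈ Finset.range J, (-u) ^ (i + 1) / (i + 1 : ℝ) + Real.log (1 + u)) +
          (-1) ^ (J + 1) / (J : ℝ) * u ^ (J + 1) := by
      rw [klFun_apply]
      linarith
    have hlast : |(-1) ^ (J + 1) / (J : ℝ) * u ^ (J + 1)| ≤ |u| ^ (J + 1) := by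
      rw [abs_mul, abs_div, abs_pow, abs_pow, abs_neg, abs_one, one_pow, Nat.abs_cast]
      refine mul_le_of_le_one_left hp ?_
      rw [div_le_one (by norm_cast)]
      exact_mod_cast hJ
    have h1u : |1 + u| ≤ 3 / 2 := by
      rw [abs_le] at h ⊢
      constructor <;> linarith
    have hmain : |klFun (1 + u) - klTaylor J u| ≤ 4 * |u| ^ (J + 1) := by
      rw [heq]
      refine (abs_add_le _ _).trans ?_
      rw [abs_mul]
      have := mul_le_mul h1u (hlog.trans hlog2) (abs_nonneg _) (by norm_num)
      linarith
    have : 0 ≤ (2 ^ (J - 1) + J * 2 ^ (J + 1) : ℝ) * |u| ^ (J + 1) := by positivity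
    linarith
  · have h1 : |klFun (1 + u)| ≤ 2 ^ (J - 1) * |u| ^ (J + 1) := by
      rw [abs_of_nonneg (klFun_nonneg (by linarith))]
      refine (klFun_le_sq (by linarith)).trans ?_
      rw [add_sub_cancel_left, ← sq_abs u]
      have h2u : 1 ≤ 2 * |u| := by linarith
      have := one_le_pow₀ h2u (n := J - 1)
      calc |u| ^ 2 ≤ (2 * |u|) ^ (J - 1) * |u| ^ 2 := by nlinarith [sq_nonneg |u|]
        _ = 2 ^ (J - 1) * (|u| ^ (J - 1) * |u| ^ 2) := by ring
        _ = _ := by rw [← pow_add]; congr 2; omega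
    have h2 := abs_klTaylor_le J h
    refine (abs_sub _ _).trans ?_
    nlinarith

end KLFun

/-! ### Densities of Gaussian mixtures. -/

section GaussianMixture

lemma continuous_mehlerKernel (θ : ℝ) : Continuous fun p : ℝ × ℝ => mehlerKernel θ p.1 p.2 := by
  unfold mehlerKernel
  fun_prop

lemma mehlerKernel_pos {θ : ℝ} (hθ : θ < 1) (y x : ℝ) : 0 < mehlerKernel θ y x := by
  have : 0 < √(1 - θ) := Real.sqrt_pos.2 (by linarith)
  unfold mehlerKernel
  positivity

lemma mehlerKernel_le {θ : ℝ} (hθ : θ < 1) (y x : ℝ) :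
    mehlerKernel θ y x ≤ (√(1 - θ))⁻¹ * Real.exp (x ^ 2 / 2) := by
  unfold mehlerKernel
  gcongr
  have : 0 ≤ (x - y) ^ 2 / (2 * (1 - θ)) := div_nonneg (sq_nonneg _) (by linarith)
  linarith

/-- Uniform over the means kept by the truncation; it bounds the logarithm of the truncated density
from below. -/
lemma le_mehlerKernel {θ y : ℝ} (hθ0 : 0 ≤ θ) (hθ : θ ≤ 1 / 2) (hy : |y| ≤ 1) (x : ℝ) :
    Real.exp (-2 * (1 + x ^ 2)) ≤ mehlerKernel θ y x := by
  have h0 : 0 < √(1 - θ) := Real.sqrt_pos.2 (by linarith)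
  have h1 : 1 ≤ (√(1 - θ))⁻¹ := by
    rw [one_le_inv₀ h0, Real.sqrt_le_one]
    linarith
  have h2 : (x - y) ^ 2 / (2 * (1 - θ)) ≤ (x - y) ^ 2 :=
    div_le_self (sq_nonneg _) (by linarith)
  have h3 : y ^ 2 ≤ 1 := by
    rw [← sq_abs]
    nlinarith [abs_nonneg y]
  calc Real.exp (-2 * (1 + x ^ 2)) ≤
      1 * Real.exp (x ^ 2 / 2 - (x - y) ^ 2 / (2 * (1 - θ))) := by
        rw [one_mul]
        apply Real.exp_le_exp.2
        nlinarith [sq_nonneg (x + y)]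
    _ ≤ _ := by
      unfold mehlerKernel
      gcongr

lemma gaussianReal_eq_withDensity {θ : ℝ} (hθ : θ < 1) (y : ℝ) :
    gaussianReal y (1 - θ).toNNReal =
      (gaussianReal 0 1).withDensity fun x => ENNReal.ofReal (mehlerKernel θ y x) := by
  have hne : (1 - θ).toNNReal ≠ 0 := by
    rw [ne_eq, Real.toNNReal_eq_zero]
    linarith
  have hm : Measurable fun x => ENNReal.ofReal (mehlerKernel θ y x) :=
    ((continuous_mehlerKernel θ).comp (by fun_prop : Continuous fun x : ℝ => (y, x))).measurable.ennreal_ofReal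
  rw [gaussianReal_of_var_ne_zero _ hne, gaussianReal_of_var_ne_zero _ one_ne_zero,
    ← withDensity_mul _ (measurable_gaussianPDF _ _) hm]
  congr 1
  ext x
  rw [Pi.mul_apply, gaussianPDF, gaussianPDF, ← ENNReal.ofReal_mul (gaussianPDFReal_nonneg _ _ _)]
  congr 1
  have h1 : 0 < 1 - θ := by linarith
  rw [gaussianPDFReal_zero_one, gaussianPDFReal, mehlerKernel, Real.coe_toNNReal _ h1.le,
    Real.sqrt_mul (by positivity), mul_inv, mul_mul_mul_comm, ← Real.exp_add]
  congr 2
  field_simp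
  ring

lemma lintegral_one_add_sq_gaussianReal (y : ℝ) (τ : NNReal) :
    ∫⁻ x, ENNReal.ofReal (1 + x ^ 2) ∂(gaussianReal y τ) = ENNReal.ofReal (1 + (τ + y ^ 2)) := by
  have h2 : MemLp (fun x : ℝ => x) 2 (gaussianReal y τ) := memLp_id_gaussianReal 2
  have hi : Integrable (fun x : ℝ => x ^ 2) (gaussianReal y τ) := h2.integrable_sq
  have hv : ∫ x, x ^ 2 ∂(gaussianReal y τ) = τ + y ^ 2 := by
    have := variance_eq_sub h2
    rw [variance_fun_id_gaussianReal, integral_id_gaussianReal] at this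
    simp only [Pi.pow_apply] at this
    linarith
  have hi' : Integrable (fun x : ℝ => 1 + x ^ 2) (gaussianReal y τ) := (integrable_const 1).add hi
  rw [← ofReal_integral_eq_lintegral_ofReal hi' (ae_of_all _ fun x => by positivity)]
  rw [integral_add (integrable_const 1) hi, hv]
  simp

/-- The density, with respect to the standard normal law, of the mixture of the normal laws with
mean `ε z` and variance `1 - θ`, where `z` has law `ρ`. -/
noncomputable def mixtureDensity (ρ : Measure ℝ) (θ ε x : ℝ) : ℝ :=
  ∫ z, mehlerKernel θ (ε * z) x ∂ρ

variable {ρ : Measure ℝ} {θ : ℝ}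

lemma integrable_mehlerKernel [IsFiniteMeasure ρ] (hθ : θ < 1) (ε x : ℝ) :
    Integrable (fun z => mehlerKernel θ (ε * z) x) ρ := by
  refine (integrable_const ((√(1 - θ))⁻¹ * Real.exp (x ^ 2 / 2))).mono' ?_
    (ae_of_all _ fun z => ?_)
  · exact ((continuous_mehlerKernel θ).comp
      (by fun_prop : Continuous fun z : ℝ => (ε * z, x))).aestronglyMeasurable
  · rw [Real.norm_of_nonneg (mehlerKernel_pos hθ _ _).le]
    exact mehlerKernel_le hθ _ _

lemma measurable_mixtureDensity [IsFiniteMeasure ρ] (θ ε : ℝ) :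
    Measurable (mixtureDensity ρ θ ε) := by
  have : StronglyMeasurable (Function.uncurry fun x z : ℝ => mehlerKernel θ (ε * z) x) :=
    ((continuous_mehlerKernel θ).comp
      (by fun_prop : Continuous fun p : ℝ × ℝ => (ε * p.2, p.1))).stronglyMeasurable
  exact this.integral_prod_right.measurable

lemma mixtureDensity_nonneg (hθ : θ < 1) (ε x : ℝ) : 0 ≤ mixtureDensity ρ θ ε x :=
  integral_nonneg fun _ => (mehlerKernel_pos hθ _ _).le

lemma mixtureDensity_le [IsProbabilityMeasure ρ] (hθ : θ < 1) (ε x : ℝ) :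
    mixtureDensity ρ θ ε x ≤ (√(1 - θ))⁻¹ * Real.exp (x ^ 2 / 2) := by
  refine (integral_mono (integrable_mehlerKernel hθ ε x) (integrable_const _)
    fun z => mehlerKernel_le hθ _ _).trans ?_
  simp

lemma lintegral_mul_mixtureDensity [IsFiniteMeasure ρ] (hθ : θ < 1) (ε : ℝ) {f : ℝ → ℝ≥0∞}
    (hf : Measurable f) :
    ∫⁻ x, f x * ENNReal.ofReal (mixtureDensity ρ θ ε x) ∂(gaussianReal 0 1) =
      ∫⁻ z, ∫⁻ x, f x ∂(gaussianReal (ε * z) (1 - θ).toNNReal) ∂ρ := by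
  have hm : Measurable fun p : ℝ × ℝ => ENNReal.ofReal (mehlerKernel θ (ε * p.2) p.1) :=
    ((continuous_mehlerKernel θ).comp
      (by fun_prop : Continuous fun p : ℝ × ℝ => (ε * p.2, p.1))).measurable.ennreal_ofReal
  have h1 : ∀ x, f x * ENNReal.ofReal (mixtureDensity ρ θ ε x) =
      ∫⁻ z, f x * ENNReal.ofReal (mehlerKernel θ (ε * z) x) ∂ρ := by
    intro x
    rw [mixtureDensity, ofReal_integral_eq_lintegral_ofReal (integrable_mehlerKernel hθ ε x)
      (ae_of_all _ fun z => (mehlerKernel_pos hθ _ _).le), lintegral_const_mul]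
    have hg : Continuous fun z : ℝ => (ε * z, x) := by fun_prop
    exact ((continuous_mehlerKernel θ).comp hg).measurable.ennreal_ofReal
  simp only [h1]
  rw [lintegral_lintegral_swap]
  · refine lintegral_congr fun z => ?_
    rw [gaussianReal_eq_withDensity hθ, lintegral_withDensity_eq_lintegral_mul _ _ hf]
    · refine lintegral_congr fun x => ?_
      rw [Pi.mul_apply, mul_comm]
    · have hg : Continuous fun x : ℝ => (ε * z, x) := by fun_prop
      exact ((continuous_mehlerKernel θ).comp hg).measurable.ennreal_ofReal
  · exact ((hf.comp measurable_fst).mul hm).aemeasurable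

lemma lintegral_one_add_sq_mul_mixtureDensity [IsFiniteMeasure ρ] (hθ : θ < 1) (ε : ℝ) :
    ∫⁻ x, ENNReal.ofReal ((1 + x ^ 2) * mixtureDensity ρ θ ε x) ∂(gaussianReal 0 1) =
      ∫⁻ z, ENNReal.ofReal (1 + ((1 - θ) + (ε * z) ^ 2)) ∂ρ := by
  have h := lintegral_mul_mixtureDensity (ρ := ρ) hθ ε
    (f := fun x => ENNReal.ofReal (1 + x ^ 2)) (by fun_prop)
  simp only [lintegral_one_add_sq_gaussianReal, Real.coe_toNNReal _ (by linarith : 0 ≤ 1 - θ)] at h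
  rw [← h]
  refine lintegral_congr fun x => ?_
  rw [ENNReal.ofReal_mul (by positivity)]

lemma integrable_one_add_sq_mul_mixtureDensity [IsFiniteMeasure ρ] (hθ : θ < 1)
    (hint : Integrable (fun z => z ^ 2) ρ) (ε : ℝ) :
    Integrable (fun x => (1 + x ^ 2) * mixtureDensity ρ θ ε x) (gaussianReal 0 1) := by
  rw [← lintegral_ofReal_ne_top_iff_integrable, lintegral_one_add_sq_mul_mixtureDensity hθ]
  · refine (Integrable.lintegral_lt_top ?_).ne
    simp only [mul_pow]
    exact (integrable_const 1).add ((integrable_const _).add (hint.const_mul _))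
  · exact ((by fun_prop : Measurable fun x : ℝ => 1 + x ^ 2).mul
      (measurable_mixtureDensity θ ε)).aestronglyMeasurable
  · exact ae_of_all _ fun x => mul_nonneg (by positivity) (mixtureDensity_nonneg hθ ε x)

lemma integral_one_add_sq_mul_mixtureDensity [IsFiniteMeasure ρ] (hθ : θ < 1)
    (hint : Integrable (fun z => z ^ 2) ρ) (ε : ℝ) :
    ∫ x, (1 + x ^ 2) * mixtureDensity ρ θ ε x ∂(gaussianReal 0 1) =
      ∫ z, (1 + ((1 - θ) + (ε * z) ^ 2)) ∂ρ := by
  have h1 : ∀ z : ℝ, 0 ≤ 1 + ((1 - θ) + (ε * z) ^ 2) := fun z => by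
    have : 0 ≤ (ε * z) ^ 2 := sq_nonneg _
    linarith
  rw [integral_eq_lintegral_of_nonneg_ae, integral_eq_lintegral_of_nonneg_ae,
    lintegral_one_add_sq_mul_mixtureDensity hθ]
  · exact ae_of_all _ h1
  · fun_prop
  · exact ae_of_all _ fun x => mul_nonneg (by positivity) (mixtureDensity_nonneg hθ ε x)
  · exact (integrable_one_add_sq_mul_mixtureDensity hθ hint ε).aestronglyMeasurable

lemma withDensity_mixtureDensity [IsFiniteMeasure ρ] (hθ : θ < 1) (ε : ℝ) {s : Set ℝ}
    (hs : MeasurableSet s) :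
    ((gaussianReal 0 1).withDensity fun x => ENNReal.ofReal (mixtureDensity ρ θ ε x)) s =
      ∫⁻ z, gaussianReal (ε * z) (1 - θ).toNNReal s ∂ρ := by
  have h := lintegral_mul_mixtureDensity (ρ := ρ) hθ ε
    (f := s.indicator 1) (measurable_one.indicator hs)
  simp only [lintegral_indicator_one hs] at h
  rw [← h, withDensity_apply _ hs, ← lintegral_indicator hs]
  refine lintegral_congr fun x => ?_
  by_cases hx : x ∈ s <;> simp [hx]

/-- The logarithm of the density is at most a constant plus `x² / 2`, so finiteness of the
divergence needs only a second moment. -/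
lemma integrable_klFun_mixtureDensity [IsProbabilityMeasure ρ] (hθ : θ < 1)
    (hint : Integrable (fun z => z ^ 2) ρ) (ε : ℝ) :
    Integrable (fun x => klFun (mixtureDensity ρ θ ε x)) (gaussianReal 0 1) := by
  set c := |Real.log (√(1 - θ))⁻¹| with hc
  have hc0 : 0 ≤ c := abs_nonneg _
  have hmaj := (integrable_const (1 : ℝ)).add
    ((integrable_one_add_sq_mul_mixtureDensity hθ hint ε).const_mul (c + 1))
  refine hmaj.mono' (measurable_klFun.comp (measurable_mixtureDensity θ ε)).aestronglyMeasurable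
    (ae_of_all _ fun x => ?_)
  have h0 := mixtureDensity_nonneg (ρ := ρ) hθ ε x
  rw [Real.norm_of_nonneg (klFun_nonneg h0), klFun_apply]
  simp only [Pi.add_apply]
  rcases h0.eq_or_lt with h | h
  · rw [← h]; simp
  · have hs : 0 < √(1 - θ) := Real.sqrt_pos.2 (by linarith)
    have h1 := Real.log_le_log h (mixtureDensity_le hθ ε x)
    rw [Real.log_mul (by positivity) (Real.exp_pos _).ne', Real.log_exp] at h1
    have h2 : Real.log (√(1 - θ))⁻¹ ≤ c := le_abs_self _
    have h3 : Real.log (mixtureDensity ρ θ ε x) ≤ (c + 1) * (1 + x ^ 2) := by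
      nlinarith [sq_nonneg x]
    have h4 := mul_le_mul_of_nonneg_left h3 h.le
    nlinarith

end GaussianMixture

/-! ### Expansion of the density after truncating the mixing variable. -/

section TruncatedExpansion

open Polynomial Topology

/-- A truncated moment, small as `ε → 0`, that controls all the error terms. -/
noncomputable def truncatedMoment (ρ : Measure ℝ) (n : ℕ) (ε : ℝ) : ℝ :=
  ∫ z, (1 + |z|) ^ n * min 1 (ε * (1 + |z|)) ∂ρ

lemma truncatedMoment_nonneg (ρ : Measure ℝ) (n : ℕ) {ε : ℝ} (hε : 0 < ε) : 0 ≤ truncatedMoment ρ n ε := by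
  refine integral_nonneg fun z => ?_
  have h0 : 0 ≤ min 1 (ε * (1 + |z|)) := le_min zero_le_one (by positivity)
  positivity

variable {ρ : Measure ℝ} [IsProbabilityMeasure ρ] {n : ℕ}

lemma integrable_one_add_abs_pow (hint : MemLp id n ρ) {k : ℕ} (hk : k ≤ n) :
    Integrable (fun z : ℝ => (1 + |z|) ^ k) ρ := by
  have h0 : MemLp (fun z : ℝ => ‖z‖) k ρ :=
    (hint.mono_exponent (q := n) (p := k) (by exact_mod_cast hk)).norm
  have h1 : MemLp (fun z : ℝ => 1 + ‖z‖) k ρ := (memLp_const (1 : ℝ)).add h0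
  refine h1.integrable_norm_pow'.congr (ae_of_all _ fun z => ?_)
  simp only
  rw [Real.norm_of_nonneg (by positivity), Real.norm_eq_abs]

lemma integrable_truncatedMoment (hint : MemLp id n ρ) {ε : ℝ} (hε : 0 < ε) :
    Integrable (fun z : ℝ => (1 + |z|) ^ n * min 1 (ε * (1 + |z|))) ρ := by
  refine (integrable_one_add_abs_pow hint le_rfl).mono' (by fun_prop) (ae_of_all _ fun z => ?_)
  have h0 : 0 ≤ min 1 (ε * (1 + |z|)) := le_min zero_le_one (by positivity)
  rw [Real.norm_of_nonneg (by positivity)]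
  exact mul_le_of_le_one_right (by positivity) (min_le_left _ _)

lemma tendsto_truncatedMoment (hint : MemLp id n ρ) :
    Tendsto (truncatedMoment ρ n) (𝓝[>] 0) (𝓝 0) := by
  have h : Tendsto (truncatedMoment ρ n) (𝓝[>] 0) (𝓝 (∫ _, (0 : ℝ) ∂ρ)) := by
    refine tendsto_integral_filter_of_dominated_convergence (fun z => (1 + |z|) ^ n) ?_ ?_
      (integrable_one_add_abs_pow hint le_rfl) (ae_of_all _ fun z => ?_)
    · exact Eventually.of_forall fun ε => by fun_prop
    · filter_upwards [self_mem_nhdsWithin] with ε hε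
      have hε : 0 < ε := hε
      refine ae_of_all _ fun z => ?_
      have h0 : 0 ≤ min 1 (ε * (1 + |z|)) := le_min zero_le_one (by positivity)
      rw [Real.norm_of_nonneg (by positivity)]
      exact mul_le_of_le_one_right (by positivity) (min_le_left _ _)
    · have hc : Continuous fun ε : ℝ => (1 + |z|) ^ n * min 1 (ε * (1 + |z|)) := by fun_prop
      have := hc.tendsto 0
      simp only [zero_mul, zero_le_one, inf_of_le_right, mul_zero] at this
      exact this.mono_left nhdsWithin_le_nhds
  simpa using h

lemma measurableSet_abs_mul_le (ε : ℝ) : MeasurableSet {z : ℝ | |ε * z| ≤ 1} :=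
  measurableSet_le (by fun_prop) measurable_const

/-- Off the truncation set `ε (1 + |z|) ≥ 1`: the minimum in `truncatedMoment` equals one, and
raising the power from `k` to `n` only increases the integrand. -/
lemma pow_mul_setIntegral_compl_le (hint : MemLp id n ρ) {ε : ℝ} (hε : 0 < ε) {k : ℕ}
    (hk : k ≤ n) :
    ε ^ k * ∫ z in {z : ℝ | |ε * z| ≤ 1}ᶜ, (1 + |z|) ^ k ∂ρ ≤ ε ^ n * truncatedMoment ρ n ε := by
  rw [truncatedMoment, ← integral_const_mul, ← integral_const_mul]
  refine (setIntegral_mono_on (g := fun z => ε ^ n * ((1 + |z|) ^ n * min 1 (ε * (1 + |z|))))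
    ((integrable_one_add_abs_pow hint hk).const_mul _).integrableOn
    ((integrable_truncatedMoment hint hε).const_mul _).integrableOn
    (measurableSet_abs_mul_le ε).compl fun z hz => ?_).trans ?_
  · have hz1 : 1 ≤ ε * (1 + |z|) := by
      simp only [Set.mem_compl_iff, Set.mem_ofPred_eq, not_le, abs_mul, abs_of_pos hε] at hz
      nlinarith
    rw [min_eq_left hz1, mul_one, ← mul_pow, ← mul_pow]
    exact pow_le_pow_right₀ hz1 hk
  · refine setIntegral_le_integral ((integrable_truncatedMoment hint hε).const_mul _)
      (ae_of_all _ fun z => ?_)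
    have h0 : 0 ≤ min 1 (ε * (1 + |z|)) := le_min zero_le_one (by positivity)
    simp only [Pi.zero_apply]
    positivity

/-- On the truncation set `ε (1 + |z|) ≤ 2`, hence it is at most twice its minimum with one. This
replaces the missing moment of order `n + 1`. -/
lemma pow_mul_setIntegral_le (hint : MemLp id n ρ) {ε : ℝ} (hε : 0 < ε) (hε1 : ε ≤ 1) :
    ∫ z in {z : ℝ | |ε * z| ≤ 1}, ε ^ (n + 1) * (1 + |z|) ^ (n + 1) ∂ρ ≤
      2 * (ε ^ n * truncatedMoment ρ n ε) := by
  have hle : ∀ z ∈ {z : ℝ | |ε * z| ≤ 1}, ε ^ (n + 1) * (1 + |z|) ^ (n + 1) ≤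
      2 * ε ^ n * ((1 + |z|) ^ n * min 1 (ε * (1 + |z|))) := by
    intro z hz
    simp only [Set.mem_ofPred_eq, abs_mul, abs_of_pos hε] at hz
    have h1 : ε * (1 + |z|) ≤ 2 * min 1 (ε * (1 + |z|)) := by
      rcases le_total 1 (ε * (1 + |z|)) with h | h
      · rw [min_eq_left h]
        nlinarith
      · rw [min_eq_right h]
        have : 0 ≤ ε * (1 + |z|) := by positivity
        linarith
    calc ε ^ (n + 1) * (1 + |z|) ^ (n + 1) = ε ^ n * (1 + |z|) ^ n * (ε * (1 + |z|)) := by ring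
      _ ≤ ε ^ n * (1 + |z|) ^ n * (2 * min 1 (ε * (1 + |z|))) := by gcongr
      _ = _ := by ring
  have hi := (integrable_truncatedMoment hint hε).const_mul (2 * ε ^ n)
  rw [← mul_assoc, truncatedMoment, ← integral_const_mul]
  have hnn : ∀ z : ℝ, 0 ≤ 2 * ε ^ n * ((1 + |z|) ^ n * min 1 (ε * (1 + |z|))) := fun z => by
    have h0 : 0 ≤ min 1 (ε * (1 + |z|)) := le_min zero_le_one (by positivity)
    positivity
  refine le_trans ?_ (setIntegral_le_integral (s := {z : ℝ | |ε * z| ≤ 1}) hi (ae_of_all _ hnn))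
  refine setIntegral_mono_on ?_ hi.integrableOn (measurableSet_abs_mul_le ε) hle
  refine hi.integrableOn.mono' (by fun_prop) ?_
  filter_upwards [ae_restrict_mem (measurableSet_abs_mul_le ε)] with z hz
  rw [Real.norm_of_nonneg (by positivity)]
  exact hle z hz

lemma integrable_gaussianShiftMoment_law (hint : MemLp id n ρ) {v : ℝ} (hv : 0 ≤ v) {k : ℕ}
    (hk : k ≤ n) : Integrable (gaussianShiftMoment v k) ρ := by
  obtain ⟨C, -, hC⟩ := exists_norm_gaussianShiftMoment_le hv k
  refine ((integrable_one_add_abs_pow hint hk).const_mul C).mono' ?_ (ae_of_all _ hC)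
  have : StronglyMeasurable (Function.uncurry fun z u : ℝ =>
      (z + Complex.I * (√v * u : ℝ) : ℂ) ^ k) :=
    Continuous.stronglyMeasurable (by unfold Function.uncurry; fun_prop)
  exact this.integral_prod_right.aestronglyMeasurable

/-- The polynomial of degree `n` in `ε` that approximates the density minus one. -/
noncomputable def hermiteSum (m : ℕ → ℝ) (n : ℕ) (ε : ℝ) : ℝ[X] :=
  ∑ k ∈ Finset.Icc 3 n, C (ε ^ k * m k) * scaledHermite k

lemma one_add_eval_hermiteSum (κ : ℕ → ℝ) (hn : 2 ≤ n) (ε x : ℝ) :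
    1 + (hermiteSum (modifiedMoment κ) n ε).eval x =
      ∑ k ∈ Finset.range (n + 1), (scaledHermite k).eval x * (ε ^ k * modifiedMoment κ k) := by
  have h : Finset.range (n + 1) = insert 0 (insert 1 (insert 2 (Finset.Icc 3 n))) := by
    ext j
    simp only [Finset.mem_range, Finset.mem_insert, Finset.mem_Icc]
    omega
  rw [h, Finset.sum_insert (by simp), Finset.sum_insert (by simp), Finset.sum_insert (by simp),
    modifiedMoment_zero, modifiedMoment_one, modifiedMoment_two, hermiteSum, eval_finsetSum]
  simp only [mul_zero, zero_add, pow_zero, mul_one, eval_mul, eval_C]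
  congr 1
  · simp [scaledHermite]
  · exact Finset.sum_congr rfl fun k _ => mul_comm _ _

/-- The density of the truncated mixture, up to an error that is small relative to `ε ^ n`. -/
theorem exists_abs_mixtureDensity_sub_le (hn : 2 ≤ n) (hint : MemLp id n ρ)
    (h1 : ∫ z, z ∂ρ = 0) {δ : ℝ} (hδ : 0 < δ) :
    ∃ C : ℝ, 0 ≤ C ∧ ∀ᶠ ε in 𝓝[>] (0 : ℝ), ∀ x,
      |mixtureDensity (ρ.restrict {z | |ε * z| ≤ 1}) ((∫ z, z ^ 2 ∂ρ) * ε ^ 2) ε x -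
          (1 + (hermiteSum (modifiedMoment (cumulant id ρ)) n ε).eval x)| ≤
        C * truncatedMoment ρ n ε * ε ^ n * Real.exp (δ * x ^ 2) := by
  set v := ∫ z, z ^ 2 ∂ρ with hvdef
  have hv : 0 ≤ v := integral_nonneg fun z => sq_nonneg z
  obtain ⟨C, hC, ε₀, hε₀, hexp⟩ := exists_mehlerKernel_expansion hv n hδ
  choose D hD hDle using fun k => exists_abs_eval_le_exp_sq (scaledHermite k) hδ
  choose B hB hBle using fun k => exists_norm_gaussianShiftMoment_le hv k
  refine ⟨2 * C + ∑ k ∈ Finset.range (n + 1), D k * B k, ?_, ?_⟩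
  · have : 0 ≤ ∑ k ∈ Finset.range (n + 1), D k * B k :=
      Finset.sum_nonneg fun k _ => mul_nonneg (hD k) (hB k)
    positivity
  have hθev : ∀ᶠ ε in 𝓝[>] (0 : ℝ), v * ε ^ 2 < 1 := by
    have hc : Continuous fun ε : ℝ => v * ε ^ 2 := by fun_prop
    exact nhdsWithin_le_nhds (hc.continuousAt.eventually_lt_const (by simp))
  filter_upwards [self_mem_nhdsWithin, Ioo_mem_nhdsGT (lt_min hε₀ one_pos), hθev]
    with ε hε hε' hθ x
  have hε : 0 < ε := hε
  have hεε₀ : ε ≤ ε₀ := (hε'.2.trans_le (min_le_left _ _)).le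
  have hε1 : ε ≤ 1 := (hε'.2.trans_le (min_le_right _ _)).le
  set A := {z : ℝ | |ε * z| ≤ 1} with hA
  have hAm : MeasurableSet A := measurableSet_abs_mul_le ε
  set T := truncatedMoment ρ n ε with hT
  set E := Real.exp (δ * x ^ 2) with hE
  set q : ℝ → ℂ := fun z => (mehlerKernel (v * ε ^ 2) (ε * z) x : ℂ) with hq
  set S : ℝ → ℂ := fun z => ∑ k ∈ Finset.range (n + 1),
    (((scaledHermite k).eval x : ℝ) : ℂ) * (ε ^ k * gaussianShiftMoment v k z) with hS
  have hqi : IntegrableOn q A ρ :=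
    (integrable_mehlerKernel (ρ := ρ) hθ ε x).ofReal.integrableOn
  have hPi : ∀ k ∈ Finset.range (n + 1), Integrable (fun z =>
      (((scaledHermite k).eval x : ℝ) : ℂ) * (ε ^ k * gaussianShiftMoment v k z)) ρ := by
    intro k hk
    rw [Finset.mem_range] at hk
    exact ((integrable_gaussianShiftMoment_law hint hv (by omega)).const_mul _).const_mul _
  have hSi : Integrable S ρ := integrable_finsetSum _ hPi
  have hSint : ∫ z, S z ∂ρ =
      ((1 + (hermiteSum (modifiedMoment (cumulant id ρ)) n ε).eval x : ℝ) : ℂ) := by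
    rw [hS, integral_finsetSum _ hPi, one_add_eval_hermiteSum _ hn, Complex.ofReal_sum]
    refine Finset.sum_congr rfl fun k hk => ?_
    rw [Finset.mem_range] at hk
    rw [integral_const_mul, integral_const_mul,
      integral_gaussianShiftMoment_eq hn hint h1 (by omega)]
    push_cast
    rfl
  have hmain : ‖∫ z in A, (q z - S z) ∂ρ‖ ≤ C * E * (2 * (ε ^ n * T)) := by
    calc ‖∫ z in A, (q z - S z) ∂ρ‖
        ≤ ∫ z in A, C * E * (ε ^ (n + 1) * (1 + |z|) ^ (n + 1)) ∂ρ := by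
          refine norm_integral_le_of_norm_le ?_ ?_
          · refine Integrable.const_mul ?_ _
            have hb : IntegrableOn (fun _ => ((ε + 1) ^ (n + 1) : ℝ)) A ρ :=
              (integrable_const _).integrableOn
            refine hb.mono' (by fun_prop) ?_
            filter_upwards [ae_restrict_mem hAm] with z hz
            rw [Real.norm_of_nonneg (by positivity), ← mul_pow]
            simp only [hA, Set.mem_ofPred_eq, abs_mul, abs_of_pos hε] at hz
            gcongr
            linarith
          · filter_upwards [ae_restrict_mem hAm] with z hz
            refine (hexp ε hε hεε₀ z x hz).trans (le_of_eq ?_)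
            ring
      _ = C * E * ∫ z in A, ε ^ (n + 1) * (1 + |z|) ^ (n + 1) ∂ρ := integral_const_mul _ _
      _ ≤ _ := by
        gcongr
        exact pow_mul_setIntegral_le hint hε hε1
  have htail : ‖∫ z in Aᶜ, S z ∂ρ‖ ≤
      ∑ k ∈ Finset.range (n + 1), D k * E * (B k * (ε ^ n * T)) := by
    rw [hS, integral_finsetSum _ fun k hk => (hPi k hk).integrableOn]
    refine (norm_sum_le _ _).trans (Finset.sum_le_sum fun k hk => ?_)
    rw [Finset.mem_range] at hk
    rw [integral_const_mul, norm_mul, Complex.norm_real]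
    have hDB := hDle k x
    have h3 : ‖∫ z in Aᶜ, (ε ^ k * gaussianShiftMoment v k z : ℂ) ∂ρ‖ ≤ B k * (ε ^ n * T) := by
      rw [integral_const_mul, norm_mul, norm_pow, Complex.norm_real, Real.norm_of_nonneg hε.le]
      have h4 : ‖∫ z in Aᶜ, gaussianShiftMoment v k z ∂ρ‖ ≤
          B k * ∫ z in Aᶜ, (1 + |z|) ^ k ∂ρ := by
        rw [← integral_const_mul]
        exact norm_integral_le_of_norm_le
          ((integrable_one_add_abs_pow hint (by omega)).const_mul _).integrableOn
          (ae_of_all _ (hBle k))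
      calc _ ≤ ε ^ k * (B k * ∫ z in Aᶜ, (1 + |z|) ^ k ∂ρ) := by gcongr
        _ = B k * (ε ^ k * ∫ z in Aᶜ, (1 + |z|) ^ k ∂ρ) := by ring
        _ ≤ _ := mul_le_mul_of_nonneg_left
          (pow_mul_setIntegral_compl_le hint hε (by omega)) (hB k)
    exact mul_le_mul hDB h3 (norm_nonneg _) (mul_nonneg (hD k) (Real.exp_pos _).le)
  -- The modified moments come from integrating over all `z`, whereas the density integrates over
  -- `A` only; the expansion on `Aᶜ` must be subtracted.
  have hsplit : ((mixtureDensity (ρ.restrict A) (v * ε ^ 2) ε x -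
      (1 + (hermiteSum (modifiedMoment (cumulant id ρ)) n ε).eval x) : ℝ) : ℂ) =
      ∫ z in A, (q z - S z) ∂ρ - ∫ z in Aᶜ, S z ∂ρ := by
    rw [Complex.ofReal_sub, ← hSint, integral_sub hqi hSi.integrableOn,
      ← integral_add_compl hAm hSi, mixtureDensity, ← integral_complex_ofReal]
    ring
  rw [← Real.norm_eq_abs, ← Complex.norm_real, hsplit]
  refine (norm_sub_le _ _).trans ((add_le_add hmain htail).trans (le_of_eq ?_))
  rw [add_mul, add_mul, add_mul, Finset.sum_mul, Finset.sum_mul, Finset.sum_mul]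
  congr 1
  · ring
  · exact Finset.sum_congr rfl fun k _ => by ring

end TruncatedExpansion

/-! ### From the density to the divergence. -/

section DivergenceExpansion

open Polynomial Topology

lemma abs_klTaylor_sub_le (J : ℕ) {u p M d : ℝ} (hu : |u| ≤ M) (hp : |p| ≤ M) (hM : 1 ≤ M)
    (hd : |u - p| ≤ d) : |klTaylor J u - klTaylor J p| ≤ J * (d * (J * M ^ J)) := by
  rw [klTaylor, klTaylor, ← Finset.sum_sub_distrib]
  refine (Finset.abs_sum_le_sum_abs _ _).trans ?_
  have h1 : ∀ j ∈ Finset.Icc 2 J, |(-1) ^ j / (j * (j - 1) : ℝ) * u ^ j -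
      (-1) ^ j / (j * (j - 1) : ℝ) * p ^ j| ≤ d * (J * M ^ J) := by
    intro j hj
    rw [Finset.mem_Icc] at hj
    have h2j : (2 : ℝ) ≤ j := by exact_mod_cast hj.1
    have hd0 : 0 ≤ d := (abs_nonneg _).trans hd
    rw [← mul_sub, abs_mul, abs_div, abs_pow, abs_neg, abs_one, one_pow,
      abs_of_pos (by nlinarith)]
    have h2 : |u ^ j - p ^ j| ≤ d * (J * M ^ J) := by
      refine (abs_pow_sub_pow_le u p j).trans ?_
      rw [mul_assoc]
      gcongr
      · exact hj.2
      · calc max |u| |p| ^ (j - 1) ≤ M ^ (j - 1) := by gcongr; exact max_le hu hp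
          _ ≤ M ^ J := pow_le_pow_right₀ hM (by omega)
    refine (mul_le_of_le_one_left (abs_nonneg _) ?_).trans h2
    rw [div_le_one (by nlinarith)]
    nlinarith
  refine (Finset.sum_le_card_nsmul _ _ _ h1).trans ?_
  rw [nsmul_eq_mul]
  have : 0 ≤ d := (abs_nonneg _).trans hd
  gcongr
  simp

lemma exists_abs_eval_hermiteSum_le (m : ℕ → ℝ) (n : ℕ) {δ : ℝ} (hδ : 0 < δ) :
    ∃ D : ℝ, 0 ≤ D ∧ ∀ ε : ℝ, 0 < ε → ε ≤ 1 → ∀ x : ℝ,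
      |(hermiteSum m n ε).eval x| ≤ D * ε ^ 3 * Real.exp (δ * x ^ 2) := by
  choose D hD hDle using fun k => exists_abs_eval_le_exp_sq (scaledHermite k) hδ
  refine ⟨∑ k ∈ Finset.Icc 3 n, |m k| * D k,
    Finset.sum_nonneg fun k _ => mul_nonneg (abs_nonneg _) (hD k), fun ε hε hε1 x => ?_⟩
  rw [hermiteSum, eval_finsetSum, Finset.sum_mul, Finset.sum_mul]
  refine (Finset.abs_sum_le_sum_abs _ _).trans (Finset.sum_le_sum fun k hk => ?_)
  rw [Finset.mem_Icc] at hk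
  rw [eval_mul, eval_C, abs_mul, abs_mul, abs_pow, abs_of_pos hε]
  calc ε ^ k * |m k| * |(scaledHermite k).eval x|
      ≤ ε ^ 3 * |m k| * (D k * Real.exp (δ * x ^ 2)) := by
        have h3 : ε ^ k ≤ ε ^ 3 := pow_le_pow_of_le_one hε.le hε1 hk.1
        have := hDle k x
        gcongr
    _ = _ := by ring

lemma continuous_klTaylor (J : ℕ) : Continuous (klTaylor J) := by
  unfold klTaylor
  fun_prop

lemma integrable_klTaylor_eval (J : ℕ) (p : ℝ[X]) :
    Integrable (fun x => klTaylor J (p.eval x)) (gaussianReal 0 1) := by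
  unfold klTaylor
  refine integrable_finsetSum _ fun j _ => Integrable.const_mul ?_ _
  simpa using integrable_eval_gaussianReal (p ^ j)

/-- If `h` is close to `1 + p` then the integral of `klFun h` is close to the one of the Taylor
polynomial of `klFun` at `p`. -/
lemma exists_abs_integral_klFun_sub_le {n : ℕ} (hn : 1 ≤ n) {D : ℝ} (hD : 0 ≤ D) :
    ∃ C : ℝ, 0 ≤ C ∧ ∀ (ε r : ℝ) (h : ℝ → ℝ) (p : ℝ[X]), 0 < ε → ε ≤ 1 → 0 ≤ r → r ≤ 1 →
      Measurable h → (∀ x, 0 ≤ h x) →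
      (∀ x, |p.eval x| ≤ D * ε ^ 3 * Real.exp (1 / (4 * (n + 1)) * x ^ 2)) →
      (∀ x, |h x - (1 + p.eval x)| ≤ r * ε ^ n * Real.exp (1 / (4 * (n + 1)) * x ^ 2)) → 3 ≤ n →
      Integrable (fun x => klFun (h x)) (gaussianReal 0 1) ∧
      |∫ x, klFun (h x) ∂(gaussianReal 0 1) - ∫ x, klTaylor n (p.eval x) ∂(gaussianReal 0 1)| ≤
        C * ((r + ε) * ε ^ n) := by
  obtain ⟨B, hB, hBle⟩ := exists_abs_klFun_sub_klTaylor_le n hn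
  set G := ∫ x, Real.exp (1 / 4 * x ^ 2) ∂(gaussianReal 0 1)
  have hG : 0 ≤ G := integral_nonneg fun x => (Real.exp_pos _).le
  -- The first summand comes from the Taylor remainder at `h - 1`, the second from replacing `h - 1`
  -- by `p` in the Taylor polynomial.
  set M := B * (D + 1) ^ (n + 1) + n * (n * (D + 1) ^ n) with hM
  have hM0 : 0 ≤ M := by positivity
  refine ⟨M * G, by positivity, fun ε r h p hε hε1 hr hr1 hmeas hpos hp hh hn3 => ?_⟩
  have hpt : ∀ x, |klFun (h x) - klTaylor n (p.eval x)| ≤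
      M * ((r + ε) * ε ^ n) * Real.exp (1 / 4 * x ^ 2) := by
    intro x
    set E := Real.exp (1 / (4 * (n + 1)) * x ^ 2) with hE
    have hE1 : 1 ≤ E := Real.one_le_exp (by positivity)
    -- The weight `1 / (4 (n + 1))` is chosen so that products of `n + 1` error factors remain
    -- integrable.
    have hEn : E ^ (n + 1) = Real.exp (1 / 4 * x ^ 2) := by
      rw [hE, ← Real.exp_nat_mul]
      congr 1
      push_cast
      field_simp
    have hεn : ε ^ n ≤ ε ^ 3 := pow_le_pow_of_le_one hε.le hε1 hn3
    have hε3 : ε ^ 3 ≤ 1 := pow_le_one₀ hε.le hε1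
    have hu3 : |h x - 1| ≤ (D + 1) * ε ^ 3 * E := by
      have h1 : h x - 1 = (h x - (1 + p.eval x)) + p.eval x := by ring
      rw [h1]
      refine (abs_add_le _ _).trans ((add_le_add (hh x) (hp x)).trans ?_)
      have : r * ε ^ n * E ≤ 1 * ε ^ 3 * E := by gcongr
      linarith
    have huM : |h x - 1| ≤ (D + 1) * E := by
      refine hu3.trans ?_
      have : (D + 1) * ε ^ 3 * E ≤ (D + 1) * 1 * E := by gcongr
      linarith
    have hpM : |p.eval x| ≤ (D + 1) * E := by
      refine (hp x).trans ?_
      have : D * ε ^ 3 * E ≤ (D + 1) * 1 * E := by gcongr; linarith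
      linarith
    have hM1 : 1 ≤ (D + 1) * E := by nlinarith
    have hd : |h x - 1 - p.eval x| ≤ r * ε ^ n * E := by
      rw [sub_sub]
      exact hh x
    have h1 := abs_klTaylor_sub_le n huM hpM hM1 hd
    have h2 := hBle (h x - 1) (by linarith [hpos x])
    rw [add_sub_cancel] at h2
    have h3 : |h x - 1| ^ (n + 1) ≤ (D + 1) ^ (n + 1) * ((r + ε) * ε ^ n) * E ^ (n + 1) := by
      calc |h x - 1| ^ (n + 1) ≤ ((D + 1) * ε ^ 3 * E) ^ (n + 1) := by gcongr
        _ = (D + 1) ^ (n + 1) * (ε ^ 3) ^ (n + 1) * E ^ (n + 1) := by rw [mul_pow, mul_pow]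
        _ ≤ (D + 1) ^ (n + 1) * ((r + ε) * ε ^ n) * E ^ (n + 1) := by
          gcongr
          calc (ε ^ 3) ^ (n + 1) ≤ ε ^ (n + 1) := by
                gcongr
                exact pow_le_of_le_one hε.le hε1 (by norm_num)
            _ = ε * ε ^ n := by ring
            _ ≤ _ := by gcongr; linarith
    have h4 : (n : ℝ) * (r * ε ^ n * E * (n * ((D + 1) * E) ^ n)) ≤
        n * (n * (D + 1) ^ n) * ((r + ε) * ε ^ n) * E ^ (n + 1) := by
      calc _ = n * (n * (D + 1) ^ n) * (r * ε ^ n) * E ^ (n + 1) := by rw [mul_pow]; ring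
        _ ≤ _ := by gcongr; linarith
    have h5 : klFun (h x) - klTaylor n (p.eval x) =
        (klFun (h x) - klTaylor n (h x - 1)) + (klTaylor n (h x - 1) - klTaylor n (p.eval x)) := by
      ring
    rw [h5, ← hEn]
    refine (abs_add_le _ _).trans ((add_le_add h2 h1).trans ?_)
    have h6 := mul_le_mul_of_nonneg_left h3 hB
    rw [hM]
    linarith
  have hmaj := (integrable_exp_mul_sq (c := 1 / 4) (by norm_num)).const_mul
    (M * ((r + ε) * ε ^ n))
  have hT := integrable_klTaylor_eval n p
  have hdiff : Integrable (fun x => klFun (h x) - klTaylor n (p.eval x)) (gaussianReal 0 1) :=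
    hmaj.mono' ((measurable_klFun.comp hmeas).sub
      ((continuous_klTaylor n).comp p.continuous).measurable).aestronglyMeasurable
      (ae_of_all _ hpt)
  have hk : Integrable (fun x => klFun (h x)) (gaussianReal 0 1) := by
    refine (hdiff.add hT).congr (ae_of_all _ fun x => ?_)
    simp
  refine ⟨hk, ?_⟩
  rw [← integral_sub hk hT]
  refine (norm_integral_le_of_norm_le hmaj
    (ae_of_all _ fun x => (Real.norm_eq_abs _).trans_le (hpt x))).trans (le_of_eq ?_)
  rw [integral_const_mul]
  ring

variable {ρ : Measure ℝ} [IsProbabilityMeasure ρ] {n : ℕ}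

lemma mixtureDensity_add_compl {θ : ℝ} (hθ : θ < 1) (ε x : ℝ) {A : Set ℝ}
    (hA : MeasurableSet A) :
    mixtureDensity (ρ.restrict A) θ ε x + mixtureDensity (ρ.restrict Aᶜ) θ ε x =
      mixtureDensity ρ θ ε x :=
  integral_add_compl hA (integrable_mehlerKernel hθ ε x)

lemma measureReal_compl_le_truncatedMoment (hint : MemLp id n ρ) {ε : ℝ} (hε : 0 < ε) :
    ρ.real {z : ℝ | |ε * z| ≤ 1}ᶜ ≤ ε ^ n * truncatedMoment ρ n ε := by
  have := pow_mul_setIntegral_compl_le hint hε (Nat.zero_le n)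
  simpa using this

/-- The large values of the mixing variable contribute little to the divergence. -/
lemma eventually_abs_integral_klFun_mixtureDensity_sub_le (hn : 2 ≤ n) (hint : MemLp id n ρ)
    {v : ℝ} (hv : 0 ≤ v) :
    ∀ᶠ ε in 𝓝[>] (0 : ℝ),
      Integrable (fun x => klFun (mixtureDensity (ρ.restrict {z | |ε * z| ≤ 1}) (v * ε ^ 2) ε x))
        (gaussianReal 0 1) →
      |∫ x, klFun (mixtureDensity ρ (v * ε ^ 2) ε x) ∂(gaussianReal 0 1) -
        ∫ x, klFun (mixtureDensity (ρ.restrict {z | |ε * z| ≤ 1}) (v * ε ^ 2) ε x)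
          ∂(gaussianReal 0 1)| ≤ 12 * (truncatedMoment ρ n ε * ε ^ n) := by
  have hθev : ∀ᶠ ε in 𝓝[>] (0 : ℝ), v * ε ^ 2 < 1 / 2 := by
    have hc : Continuous fun ε : ℝ => v * ε ^ 2 := by fun_prop
    exact nhdsWithin_le_nhds (hc.continuousAt.eventually_lt_const (by simp))
  have hTev : ∀ᶠ ε in 𝓝[>] (0 : ℝ), truncatedMoment ρ n ε < 1 / 2 :=
    (tendsto_truncatedMoment hint).eventually_lt_const (by norm_num)
  have hint2 : Integrable (fun z : ℝ => z ^ 2) ρ := by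
    have : MemLp id 2 ρ := hint.mono_exponent (by exact_mod_cast hn)
    exact this.integrable_sq
  filter_upwards [self_mem_nhdsWithin, Ioo_mem_nhdsGT one_pos, hθev, hTev]
    with ε hε hε' hθ hT hk0
  have hε : 0 < ε := hε
  have hε1 : ε ≤ 1 := hε'.2.le
  have hθ1 : v * ε ^ 2 < 1 := by linarith
  have hθ0 : 0 ≤ v * ε ^ 2 := by positivity
  have hT0 := truncatedMoment_nonneg ρ n hε
  set A := {z : ℝ | |ε * z| ≤ 1} with hA
  have hAm : MeasurableSet A := measurableSet_abs_mul_le ε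
  have hAc : ρ.real Aᶜ ≤ 1 / 2 := by
    refine (measureReal_compl_le_truncatedMoment hint hε).trans ?_
    have : ε ^ n ≤ 1 := pow_le_one₀ hε.le hε1
    nlinarith
  have hA2 : 1 / 2 ≤ ρ.real A := by
    have := probReal_add_probReal_compl (μ := ρ) hAm
    linarith
  -- At least half of the mass of `ρ` lies in `A`; the factor `1/2` is absorbed by doubling the
  -- exponent.
  have hlow : ∀ x, Real.exp (-4 * (1 + x ^ 2)) ≤ mixtureDensity (ρ.restrict A) (v * ε ^ 2) ε x := by
    intro x
    have h1 : ρ.real A * Real.exp (-2 * (1 + x ^ 2)) ≤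
        mixtureDensity (ρ.restrict A) (v * ε ^ 2) ε x := by
      rw [← smul_eq_mul, ← setIntegral_const]
      refine setIntegral_mono_on (integrable_const _).integrableOn
        (integrable_mehlerKernel hθ1 ε x).integrableOn hAm fun z hz => ?_
      exact le_mehlerKernel hθ0 hθ.le hz x
    have h2 : Real.exp (-4 * (1 + x ^ 2)) ≤ 1 / 2 * Real.exp (-2 * (1 + x ^ 2)) := by
      have h3 : Real.exp (-4 * (1 + x ^ 2)) =
          Real.exp (-2 * (1 + x ^ 2)) * Real.exp (-2 * (1 + x ^ 2)) := by
        rw [← Real.exp_add]; congr 1; ring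
      rw [h3]
      gcongr
      have h4 : Real.exp (-2 * (1 + x ^ 2)) ≤ Real.exp (-1) :=
        Real.exp_le_exp.2 (by nlinarith [sq_nonneg x])
      have h5 := Real.exp_neg_one_lt_half
      linarith
    refine h2.trans (le_trans ?_ h1)
    gcongr
  have hupp : ∀ x, mixtureDensity ρ (v * ε ^ 2) ε x ≤ Real.exp (4 * (1 + x ^ 2)) := by
    intro x
    refine (mixtureDensity_le hθ1 ε x).trans ?_
    have hs : (√(1 - v * ε ^ 2))⁻¹ ≤ 2 := by
      rw [inv_le_comm₀ (Real.sqrt_pos.2 (by linarith)) two_pos]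
      apply Real.le_sqrt_of_sq_le
      linarith
    have h2 : (2 : ℝ) ≤ Real.exp 1 := by
      have := Real.add_one_le_exp 1
      linarith
    calc _ ≤ Real.exp 1 * Real.exp (x ^ 2 / 2) := by gcongr; exact hs.trans h2
      _ = Real.exp (1 + x ^ 2 / 2) := (Real.exp_add _ _).symm
      _ ≤ _ := Real.exp_le_exp.2 (by nlinarith [sq_nonneg x])
  have hpt : ∀ x, |klFun (mixtureDensity ρ (v * ε ^ 2) ε x) -
      klFun (mixtureDensity (ρ.restrict A) (v * ε ^ 2) ε x)| ≤
      4 * ((1 + x ^ 2) * mixtureDensity (ρ.restrict Aᶜ) (v * ε ^ 2) ε x) := by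
    intro x
    have hpos := (Real.exp_pos _).trans_le (hlow x)
    have hnn := mixtureDensity_nonneg (ρ := ρ.restrict Aᶜ) hθ1 ε x
    have hadd := mixtureDensity_add_compl (ρ := ρ) hθ1 ε x hAm
    rw [← hadd]
    refine (abs_klFun_add_sub_le (A := 4 * (1 + x ^ 2)) (B := 4 * (1 + x ^ 2)) hpos hnn ?_ ?_
      le_rfl).trans (le_of_eq (by ring))
    · rw [Real.le_log_iff_exp_le hpos, ← neg_mul]
      exact hlow x
    · rw [Real.log_le_iff_le_exp (by linarith), hadd]
      exact hupp x
  have hk := integrable_klFun_mixtureDensity (ρ := ρ) hθ1 hint2 ε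
  have hm := (integrable_one_add_sq_mul_mixtureDensity (ρ := ρ.restrict Aᶜ) hθ1
    hint2.integrableOn ε).const_mul 4
  rw [← integral_sub hk hk0]
  refine (norm_integral_le_of_norm_le hm
    (ae_of_all _ fun x => (Real.norm_eq_abs _).trans_le (hpt x))).trans ?_
  -- The Gaussian integral of the discarded density against `1 + x²` is a second moment over `Aᶜ`,
  -- hence at most `3 ε^n T` with `T` the truncated moment.
  rw [integral_const_mul, integral_one_add_sq_mul_mixtureDensity hθ1 hint2.integrableOn]
  have h2 : ∫ z in Aᶜ, (1 + (1 - v * ε ^ 2 + (ε * z) ^ 2)) ∂ρ ≤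
      ∫ z in Aᶜ, (2 + ε ^ 2 * (1 + |z|) ^ 2) ∂ρ := by
    have hi : Integrable (fun z : ℝ => 2 + ε ^ 2 * (1 + |z|) ^ 2) ρ :=
      (integrable_const _).add ((integrable_one_add_abs_pow hint hn).const_mul _)
    have hi' : Integrable (fun z : ℝ => 1 + (1 - v * ε ^ 2 + (ε * z) ^ 2)) ρ := by
      simp only [mul_pow]
      exact (integrable_const 1).add ((integrable_const _).add (hint2.const_mul _))
    refine setIntegral_mono hi'.integrableOn hi.integrableOn fun z => ?_
    have h3 : (ε * z) ^ 2 ≤ ε ^ 2 * (1 + |z|) ^ 2 := by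
      rw [mul_pow, ← sq_abs z]
      gcongr
      linarith
    simp only
    linarith
  have h3 : ∫ z in Aᶜ, (2 + ε ^ 2 * (1 + |z|) ^ 2) ∂ρ ≤ 3 * (ε ^ n * truncatedMoment ρ n ε) := by
    rw [integral_add (integrable_const _)
      ((integrable_one_add_abs_pow hint hn).const_mul _).integrableOn, integral_const_mul,
      setIntegral_const, smul_eq_mul]
    have h4 := pow_mul_setIntegral_compl_le hint hε hn
    have h5 := measureReal_compl_le_truncatedMoment hint hε
    rw [← hA] at h4 h5
    linarith
  linarith

/-- The divergence of the mixture from the standard normal law, up to `o(ε ^ n)`. -/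
theorem isLittleO_integral_klFun_mixtureDensity (hn : 3 ≤ n) (hint : MemLp id n ρ)
    (h1 : ∫ z, z ∂ρ = 0) :
    (fun ε => ∫ x, klFun (mixtureDensity ρ ((∫ z, z ^ 2 ∂ρ) * ε ^ 2) ε x) ∂(gaussianReal 0 1) -
        ∫ x, klTaylor n ((hermiteSum (modifiedMoment (cumulant id ρ)) n ε).eval x)
          ∂(gaussianReal 0 1)) =o[𝓝[>] (0 : ℝ)] fun ε => ε ^ n := by
  have hδ : (0 : ℝ) < 1 / (4 * (n + 1)) := by positivity
  obtain ⟨C₁, hC₁, hexp⟩ := exists_abs_mixtureDensity_sub_le (by omega : 2 ≤ n) hint h1 hδ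
  obtain ⟨D, hD, hp⟩ := exists_abs_eval_hermiteSum_le (modifiedMoment (cumulant id ρ)) n hδ
  obtain ⟨C₂, hC₂, hkl⟩ := exists_abs_integral_klFun_sub_le (by omega : 1 ≤ n) hD
  have htail := eventually_abs_integral_klFun_mixtureDensity_sub_le (by omega : 2 ≤ n) hint
    (integral_nonneg fun z => sq_nonneg z : 0 ≤ ∫ z, z ^ 2 ∂ρ)
  have hT := tendsto_truncatedMoment hint
  set v := ∫ z, z ^ 2 ∂ρ with hvdef
  have hv : 0 ≤ v := integral_nonneg fun z => sq_nonneg z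
  have hθev : ∀ᶠ ε in 𝓝[>] (0 : ℝ), v * ε ^ 2 < 1 := by
    have hc : Continuous fun ε : ℝ => v * ε ^ 2 := by fun_prop
    exact nhdsWithin_le_nhds (hc.continuousAt.eventually_lt_const (by simp))
  have hr : Tendsto (fun ε => C₁ * truncatedMoment ρ n ε) (𝓝[>] 0) (𝓝 0) := by
    simpa using hT.const_mul C₁
  have hr1 : ∀ᶠ ε in 𝓝[>] (0 : ℝ), C₁ * truncatedMoment ρ n ε < 1 :=
    hr.eventually_lt_const one_pos
  have hid : Tendsto (fun ε : ℝ => ε) (𝓝[>] 0) (𝓝 0) := nhdsWithin_le_nhds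
  have hφ : Tendsto (fun ε => 12 * truncatedMoment ρ n ε +
      C₂ * (C₁ * truncatedMoment ρ n ε + ε)) (𝓝[>] 0) (𝓝 0) := by
    have := (hT.const_mul 12).add ((hr.add hid).const_mul C₂)
    simpa using this
  have hbound : ∀ᶠ ε in 𝓝[>] (0 : ℝ),
      ‖∫ x, klFun (mixtureDensity ρ (v * ε ^ 2) ε x) ∂(gaussianReal 0 1) -
        ∫ x, klTaylor n ((hermiteSum (modifiedMoment (cumulant id ρ)) n ε).eval x)
          ∂(gaussianReal 0 1)‖ ≤
      ‖(12 * truncatedMoment ρ n ε + C₂ * (C₁ * truncatedMoment ρ n ε + ε)) * ε ^ n‖ := by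
    filter_upwards [self_mem_nhdsWithin, Ioo_mem_nhdsGT one_pos, hexp, htail, hθev, hr1]
      with ε hε hε' hexpε htailε hθ hr1ε
    have hε : 0 < ε := hε
    have hT0 := truncatedMoment_nonneg ρ n hε
    obtain ⟨hk0, hmain⟩ := hkl ε (C₁ * truncatedMoment ρ n ε) _ _ hε hε'.2.le (by positivity)
      hr1ε.le (measurable_mixtureDensity (ρ := ρ.restrict {z | |ε * z| ≤ 1}) (v * ε ^ 2) ε)
      (mixtureDensity_nonneg hθ ε) (hp ε hε hε'.2.le) hexpε hn
    have h2 := htailε hk0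
    rw [Real.norm_eq_abs, Real.norm_of_nonneg (by positivity)]
    refine (abs_sub_le _ _ _).trans ((add_le_add h2 hmain).trans (le_of_eq ?_))
    ring
  refine (IsBigO.of_bound' hbound).trans_isLittleO ?_
  have := ((isLittleO_one_iff ℝ).2 hφ).mul_isBigO (isBigO_refl (fun ε : ℝ => ε ^ n) (𝓝[>] 0))
  simpa using this

end DivergenceExpansion

/-! ### Universal coefficients of the expansion. -/

section DivergenceCoefficients

open Polynomial Topology

/-- The universal coefficient of the monomial indexed by a multiset in the expansion of the
divergence. -/
noncomputable def multisetWeight (s : Multiset ℕ) : ℝ :=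
  (-1) ^ s.card / (s.card * (s.card - 1) : ℝ) * s.countPerms *
    ∫ x, ((s.map scaledHermite).prod).eval x ∂(gaussianReal 0 1)

/-- The universal coefficients of the expansion of the divergence. -/
noncomputable def divergenceWeight (k : ℕ) (p : Nat.Partition (2 * k)) : ℝ :=
  2 * k ! * multisetWeight p.parts

lemma prod_map_C_mul_scaledHermite (m : ℕ → ℝ) (ε : ℝ) (s : Multiset ℕ) :
    (s.map fun k => C (ε ^ k * m k) * scaledHermite k).prod =
      C (ε ^ s.sum * (s.map m).prod) * (s.map scaledHermite).prod := by
  induction s using Multiset.induction with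
  | empty => simp
  | cons a s ih =>
    rw [Multiset.map_cons, Multiset.prod_cons, ih]
    simp only [Multiset.map_cons, Multiset.prod_cons, Multiset.sum_cons, pow_add, C_mul]
    ring

/-- The multinomial theorem; `countPerms` counts the orderings of a multiset, and its sum is the
power of `ε` that it carries. -/
lemma integral_hermiteSum_pow (m : ℕ → ℝ) (n j : ℕ) (ε : ℝ) :
    (-1) ^ j / (j * (j - 1) : ℝ) * ∫ x, (hermiteSum m n ε).eval x ^ j ∂(gaussianReal 0 1) =
      ∑ s ∈ (Finset.Icc 3 n).sym j,
        multisetWeight s.val * (s.val.map m).prod * ε ^ s.val.sum := by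
  have h1 : hermiteSum m n ε ^ j = ∑ s ∈ (Finset.Icc 3 n).sym j,
      C (s.val.countPerms * (ε ^ s.val.sum * (s.val.map m).prod)) *
        (s.val.map scaledHermite).prod := by
    rw [hermiteSum, Finset.sum_pow]
    refine Finset.sum_congr rfl fun s _ => ?_
    rw [prod_map_C_mul_scaledHermite, C_mul (a := (s.val.countPerms : ℝ)), mul_assoc]
    simp
  simp only [← eval_pow, h1, eval_finsetSum]
  rw [integral_finsetSum _ fun s _ => integrable_eval_gaussianReal _, Finset.mul_sum]
  refine Finset.sum_congr rfl fun s _ => ?_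
  simp only [eval_mul (p := C _), eval_C]
  rw [integral_const_mul, multisetWeight]
  have : Multiset.card s.val = j := s.2
  rw [this]
  ring

lemma integral_hermiteSum_sq (m : ℕ → ℝ) (n : ℕ) (ε : ℝ) :
    ∫ x, (hermiteSum m n ε).eval x ^ 2 ∂(gaussianReal 0 1) =
      ∑ k ∈ Finset.Icc 3 n, m k ^ 2 / k ! * ε ^ (2 * k) := by
  have h1 : hermiteSum m n ε ^ 2 = ∑ k ∈ Finset.Icc 3 n, ∑ l ∈ Finset.Icc 3 n,
      C (ε ^ k * m k * (ε ^ l * m l)) * (scaledHermite k * scaledHermite l) := by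
    rw [hermiteSum, pow_two, Finset.sum_mul_sum]
    refine Finset.sum_congr rfl fun k _ => Finset.sum_congr rfl fun l _ => ?_
    rw [C_mul (a := ε ^ k * m k)]
    ring
  simp only [← eval_pow, h1, eval_finsetSum]
  rw [integral_finsetSum _ fun k _ => integrable_finsetSum _ fun l _ =>
    integrable_eval_gaussianReal _]
  refine Finset.sum_congr rfl fun k hk => ?_
  rw [integral_finsetSum _ fun l _ => integrable_eval_gaussianReal _]
  simp only [eval_mul (p := C _), eval_C]
  simp only [integral_const_mul, integral_scaledHermite_mul, mul_ite, mul_zero]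
  rw [Finset.sum_ite_eq, if_pos hk]
  ring

/-- The multisets with at least three elements that occur in the expansion to order `n`. -/
def expansionMultisets (n : ℕ) : Finset (Multiset ℕ) :=
  (Finset.Icc 3 n).biUnion fun j => ((Finset.Icc 3 n).sym j).image fun s : Sym ℕ j => s.1

lemma mem_expansionMultisets {n : ℕ} {s : Multiset ℕ} :
    s ∈ expansionMultisets n ↔
      (3 ≤ s.card ∧ s.card ≤ n) ∧ ∀ i ∈ s, 3 ≤ i ∧ i ≤ n := by
  simp only [expansionMultisets, Finset.mem_biUnion, Finset.mem_Icc, Finset.mem_image,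
    Finset.mem_sym_iff]
  constructor
  · rintro ⟨j, hj, t, ht, rfl⟩
    have : Multiset.card t.val = j := t.2
    rw [this]
    exact ⟨hj, fun i hi => ht i hi⟩
  · rintro ⟨h1, h2⟩
    exact ⟨s.card, h1, ⟨s, rfl⟩, fun i hi => h2 i hi, rfl⟩

lemma sum_expansionMultisets (n : ℕ) (f : Multiset ℕ → ℝ) :
    ∑ s ∈ expansionMultisets n, f s =
      ∑ j ∈ Finset.Icc 3 n, ∑ s ∈ (Finset.Icc 3 n).sym j, f s.val := by
  rw [expansionMultisets, Finset.sum_biUnion]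
  · exact Finset.sum_congr rfl fun j _ => Finset.sum_image fun a _ b _ h => Subtype.ext h
  · intro i _ j _ hij
    rw [Function.onFun, Finset.disjoint_left]
    intro s hs hs'
    rw [Finset.mem_image] at hs hs'
    obtain ⟨a, -, rfl⟩ := hs
    obtain ⟨b, -, hb⟩ := hs'
    have ha : Multiset.card a.val = i := a.2
    have hb' : Multiset.card b.val = j := b.2
    exact hij (by rw [← ha, ← hb', hb])

lemma integral_klTaylor_hermiteSum (m : ℕ → ℝ) {n : ℕ} (hn : 2 ≤ n) (ε : ℝ) :
    ∫ x, klTaylor n ((hermiteSum m n ε).eval x) ∂(gaussianReal 0 1) =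
      ∑ k ∈ Finset.Icc 3 n, m k ^ 2 / (2 * k !) * ε ^ (2 * k) +
        ∑ s ∈ expansionMultisets n, multisetWeight s * (s.map m).prod * ε ^ s.sum := by
  unfold klTaylor
  have hi : ∀ j ∈ Finset.Icc 2 n, Integrable (fun x => (-1) ^ j / (j * (j - 1) : ℝ) *
      (hermiteSum m n ε).eval x ^ j) (gaussianReal 0 1) := fun j _ => by
    refine Integrable.const_mul ?_ _
    simpa using integrable_eval_gaussianReal (hermiteSum m n ε ^ j)
  have hIcc : Finset.Icc 2 n = insert 2 (Finset.Icc 3 n) := by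
    ext j
    simp only [Finset.mem_Icc, Finset.mem_insert]
    omega
  rw [integral_finsetSum _ hi, hIcc, Finset.sum_insert (by simp), sum_expansionMultisets]
  simp only [integral_const_mul]
  congr 1
  · rw [integral_hermiteSum_sq, Finset.mul_sum]
    refine Finset.sum_congr rfl fun k _ => ?_
    have hk : (k ! : ℝ) ≠ 0 := by positivity
    field_simp
    norm_num
    ring
  · exact Finset.sum_congr rfl fun j _ => integral_hermiteSum_pow m n j ε

lemma multisetWeight_of_odd {s : Multiset ℕ} (hs : Odd s.sum) : multisetWeight s = 0 := by
  rw [multisetWeight, integral_prod_scaledHermite_of_odd hs, mul_zero]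

/-- A multiset of even sum `2k` is a partition of `2k`. The bounds by `2K` on its size and parts are
automatic once `k ≤ K`, and three parts of size at least 3 force `k ≥ 3`. -/
lemma sum_filter_expansionMultisets (K : ℕ) (f : Multiset ℕ → ℝ)
    (hf : ∀ s : Multiset ℕ, Odd s.sum → f s = 0) :
    ∑ s ∈ expansionMultisets (2 * K) with s.sum ≤ 2 * K, f s =
      ∑ k ∈ Finset.Icc 3 K, ∑ p : Nat.Partition (2 * k) with
        3 ≤ p.parts.card ∧ ∀ i ∈ p.parts, 3 ≤ i, f p.parts := by
  rw [Finset.sum_sigma', ← Finset.sum_filter_add_sum_filter_not _ fun s : Multiset ℕ => Odd s.sum,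
    Finset.sum_eq_zero (s := Finset.filter _ (Finset.filter _ _)) fun s hs =>
      hf s (Finset.mem_filter.1 hs).2, zero_add]
  symm
  refine Finset.sum_bij (fun x _ => x.2.parts) ?_ ?_ ?_ ?_
  · rintro ⟨k, p⟩ hp
    simp only [Finset.mem_sigma, Finset.mem_Icc, Finset.mem_filter, Finset.mem_univ,
      true_and] at hp
    obtain ⟨⟨-, hk⟩, hc, hp3⟩ := hp
    have hsum := p.parts_sum
    have hcard : p.parts.card ≤ 2 * k := by
      have := Multiset.card_nsmul_le_sum (s := p.parts) (a := 1) fun i hi => p.parts_pos hi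
      simpa [hsum] using this
    simp only [Finset.mem_filter, mem_expansionMultisets, hsum]
    refine ⟨⟨⟨⟨hc, by omega⟩, fun i hi => ⟨hp3 i hi, ?_⟩⟩, by omega⟩, by simp⟩
    have := Multiset.le_sum_of_mem hi
    omega
  · rintro ⟨k, p⟩ _ ⟨k', p'⟩ _ h
    simp only at h
    have hk : k = k' := by
      have h1 := p.parts_sum
      have h2 := p'.parts_sum
      rw [h] at h1
      omega
    subst hk
    rw [Nat.Partition.ext h]
  · intro s hs
    simp only [Finset.mem_filter, mem_expansionMultisets, Nat.not_odd_iff_even] at hs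
    obtain ⟨⟨⟨⟨hc, -⟩, hp⟩, hsum⟩, heven⟩ := hs
    obtain ⟨k, hk⟩ := heven
    have h3 : 3 * 3 ≤ s.sum := by
      have := Multiset.card_nsmul_le_sum (s := s) (a := 3) fun i hi => (hp i hi).1
      rw [smul_eq_mul] at this
      nlinarith
    refine ⟨⟨k, ⟨s, fun {i} hi => by have := (hp i hi).1; omega, by omega⟩⟩, ?_, rfl⟩
    simp only [Finset.mem_sigma, Finset.mem_Icc, Finset.mem_filter, Finset.mem_univ, true_and]
    exact ⟨⟨by omega, by omega⟩, hc, fun i hi => (hp i hi).1⟩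
  · rintro ⟨k, p⟩ _
    rfl

lemma isLittleO_const_mul_pow {n k : ℕ} (h : n < k) (c : ℝ) :
    (fun ε : ℝ => c * ε ^ k) =o[𝓝[>] (0 : ℝ)] fun ε => ε ^ n :=
  ((isLittleO_pow_pow h).mono nhdsWithin_le_nhds).const_mul_left c

theorem isLittleO_integral_klTaylor_hermiteSum (m : ℕ → ℝ) {K : ℕ} (hK : 3 ≤ K) :
    (fun ε => ∫ x, klTaylor (2 * K) ((hermiteSum m (2 * K) ε).eval x) ∂(gaussianReal 0 1) -
        ∑ k ∈ Finset.Icc 3 K, divergenceCoeff divergenceWeight m k / (2 * (k ! : ℝ)) *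
          ε ^ (2 * k)) =o[𝓝[>] (0 : ℝ)] fun ε => ε ^ (2 * K) := by
  -- What survives the subtraction carries only powers of `ε` above `2K`: squares with `k > K`, and
  -- multisets with sum above `2K`.
  have hsplit : ∀ ε : ℝ, ∫ x, klTaylor (2 * K) ((hermiteSum m (2 * K) ε).eval x)
        ∂(gaussianReal 0 1) -
      ∑ k ∈ Finset.Icc 3 K, divergenceCoeff divergenceWeight m k / (2 * (k ! : ℝ)) * ε ^ (2 * k) =
      ∑ k ∈ Finset.Ioc K (2 * K), m k ^ 2 / (2 * k !) * ε ^ (2 * k) +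
        ∑ s ∈ expansionMultisets (2 * K) with ¬ s.sum ≤ 2 * K,
          multisetWeight s * (s.map m).prod * ε ^ s.sum := by
    intro ε
    rw [integral_klTaylor_hermiteSum m (by omega),
      ← Finset.sum_filter_add_sum_filter_not (expansionMultisets _) fun s => s.sum ≤ 2 * K,
      sum_filter_expansionMultisets K
        (fun s => multisetWeight s * (s.map m).prod * ε ^ s.sum) fun s hs => by
          rw [multisetWeight_of_odd hs]; ring]
    have hIcc : Finset.Icc 3 (2 * K) = Finset.Icc 3 K ∪ Finset.Ioc K (2 * K) := by
      ext j
      simp only [Finset.mem_Icc, Finset.mem_union, Finset.mem_Ioc]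
      omega
    have hdisj : Disjoint (Finset.Icc 3 K) (Finset.Ioc K (2 * K)) := by
      rw [Finset.disjoint_left]
      intro j hj hj'
      rw [Finset.mem_Icc] at hj
      rw [Finset.mem_Ioc] at hj'
      omega
    rw [hIcc, Finset.sum_union hdisj]
    have hcoef : ∑ k ∈ Finset.Icc 3 K, divergenceCoeff divergenceWeight m k / (2 * (k ! : ℝ)) *
        ε ^ (2 * k) = ∑ k ∈ Finset.Icc 3 K, m k ^ 2 / (2 * k !) * ε ^ (2 * k) +
        ∑ k ∈ Finset.Icc 3 K, ∑ p : Nat.Partition (2 * k) with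
          3 ≤ p.parts.card ∧ ∀ i ∈ p.parts, 3 ≤ i,
          multisetWeight p.parts * (p.parts.map m).prod * ε ^ p.parts.sum := by
      rw [← Finset.sum_add_distrib]
      refine Finset.sum_congr rfl fun k _ => ?_
      rw [divergenceCoeff, add_div, add_mul, Finset.sum_div, Finset.sum_mul]
      congr 1
      refine Finset.sum_congr rfl fun p _ => ?_
      have hk : (k ! : ℝ) ≠ 0 := by positivity
      rw [p.parts_sum, divergenceWeight]
      field_simp
    rw [hcoef]
    ring
  simp only [hsplit]
  refine IsLittleO.add (IsLittleO.fun_sum fun k hk => ?_) (IsLittleO.fun_sum fun s hs => ?_)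
  · rw [Finset.mem_Ioc] at hk
    exact isLittleO_const_mul_pow (by omega) _
  · rw [Finset.mem_filter] at hs
    exact isLittleO_const_mul_pow (by omega) _

end DivergenceCoefficients

/-! ### The noisy variable as a Gaussian mixture. -/

section NoisyVariable

open Topology

lemma memLp_of_hasLaw_gaussianReal {Ω : Type*} [MeasurableSpace Ω] {P : Measure Ω} {N : Ω → ℝ}
    {τ : NNReal} (hN : HasLaw N (gaussianReal 0 τ) P) :
    MemLp N 2 P := by
  have h : MemLp id 2 (P.map N) := by
    rw [hN.map_eq]
    exact memLp_id_gaussianReal 2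
  rwa [memLp_map_measure_iff (by fun_prop) hN.aemeasurable] at h

lemma integral_sq_centered {Ω : Type*} [MeasurableSpace Ω] {P : Measure Ω} {Z : Ω → ℝ}
    (hZ : AEMeasurable Z P) :
    ∫ z, z ^ 2 ∂(P.map fun ω => Z ω - P[Z]) = Var[Z; P] := by
  rw [integral_map (hZ.sub_const _) (by fun_prop), variance_eq_integral hZ]

lemma stdDev_add_noise {Ω : Type*} [MeasurableSpace Ω] {P : Measure Ω} {Z N : Ω → ℝ} {s : ℝ}
    (hZ : MemLp Z 2 P) (hN : HasLaw N (gaussianReal 0 (Real.toNNReal (s ^ 2))) P) (hind : IndepFun Z N P) :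
    stdDev (fun ω => Z ω + N ω) P = √(Var[Z; P] + s ^ 2) := by
  rw [stdDev]
  congr 1
  have h := hind.variance_add hZ (memLp_of_hasLaw_gaussianReal hN)
  rw [hN.variance_eq, variance_id_gaussianReal, Real.coe_toNNReal _ (sq_nonneg s)] at h
  exact h

variable {Ω : Type*} [MeasurableSpace Ω] {P : Measure Ω} [IsProbabilityMeasure P] {Z N : Ω → ℝ}
  {s : ℝ}

lemma integral_add_noise (hZ : Integrable Z P)
    (hN : HasLaw N (gaussianReal 0 (Real.toNNReal (s ^ 2))) P) :
    ∫ ω, (Z ω + N ω) ∂P = ∫ ω, Z ω ∂P := by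
  rw [integral_add hZ ((memLp_of_hasLaw_gaussianReal hN).integrable one_le_two), hN.integral_eq,
    integral_id_gaussianReal, add_zero]

lemma charFun_add_noise (hZ : AEMeasurable Z P)
    (hN : HasLaw N (gaussianReal 0 (Real.toNNReal (s ^ 2))) P) (hind : IndepFun Z N P) (t : ℝ) :
    charFun (P.map fun ω => Z ω + N ω) t =
      charFun (P.map Z) t * Complex.exp (0 * t + (-(s ^ 2 / 2) : ℂ) * t ^ 2) := by
  rw [hind.charFun_map_fun_add_eq_mul hZ hN.aemeasurable, Pi.mul_apply, hN.map_eq,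
    charFun_gaussianReal, Real.coe_toNNReal _ (sq_nonneg s)]
  congr 2
  push_cast
  ring

/-- The law of the standardized noisy variable is a Gaussian mixture. -/
lemma map_standardized_eq_withDensity (hZ : AEMeasurable Z P)
    (hN : HasLaw N (gaussianReal 0 (Real.toNNReal (s ^ 2))) P) (hind : IndepFun Z N P)
    (a : ℝ) {ε θ : ℝ} (hθ : θ < 1) (hεθ : ε ^ 2 * s ^ 2 = 1 - θ) :
    P.map (fun ω => ε * (Z ω - a) + ε * N ω) =
      (gaussianReal 0 1).withDensity fun x =>
        ENNReal.ofReal (mixtureDensity (P.map fun ω => Z ω - a) θ ε x) := by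
  have hZa : AEMeasurable (fun ω => Z ω - a) P := hZ.sub_const a
  have := Measure.isProbabilityMeasure_map (μ := P) hZa
  have hind' : IndepFun (fun ω => Z ω - a) N P :=
    hind.comp (measurable_id.sub_const a) measurable_id
  have hprod := (indepFun_iff_map_prod_eq_prod_map_map hZa hN.aemeasurable).1 hind'
  have hφ : Measurable fun p : ℝ × ℝ => ε * p.1 + ε * p.2 := by fun_prop
  have h1 : P.map (fun ω => ε * (Z ω - a) + ε * N ω) =
      (P.map fun ω => (Z ω - a, N ω)).map fun p : ℝ × ℝ => ε * p.1 + ε * p.2 := by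
    rw [AEMeasurable.map_map_of_aemeasurable hφ.aemeasurable (hZa.prodMk hN.aemeasurable)]
    rfl
  ext S hS
  rw [h1, hprod, hN.map_eq, Measure.map_apply hφ hS, Measure.prod_apply (hφ hS),
    withDensity_mixtureDensity hθ ε hS]
  refine lintegral_congr fun z => ?_
  have hlaw : (gaussianReal 0 (Real.toNNReal (s ^ 2))).map (fun u => ε * z + ε * u) =
      gaussianReal (ε * z) (1 - θ).toNNReal := by
    have : (fun u : ℝ => ε * z + ε * u) = (fun u => ε * z + u) ∘ fun u => ε * u := rfl
    rw [this, ← Measure.map_map (by fun_prop) (by fun_prop), gaussianReal_map_const_mul,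
      gaussianReal_map_const_add]
    congr 1
    · simp
    · rw [← hεθ]
      ext
      simp [Real.coe_toNNReal _ (sq_nonneg s),
        Real.coe_toNNReal _ (by positivity : 0 ≤ ε ^ 2 * s ^ 2)]
  rw [← hlaw, Measure.map_apply (by fun_prop) hS]
  rfl

lemma klDiv_withDensity_mixtureDensity {ρ : Measure ℝ} [IsProbabilityMeasure ρ] {θ : ℝ}
    (hθ : θ < 1) (hint : Integrable (fun z => z ^ 2) ρ) (ε : ℝ) {μ : Measure ℝ}
    [IsProbabilityMeasure μ]
    (hμ : μ = (gaussianReal 0 1).withDensity fun x => ENNReal.ofReal (mixtureDensity ρ θ ε x)) :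
    klDiv μ (gaussianReal 0 1) ≠ ∞ ∧ (klDiv μ (gaussianReal 0 1)).toReal =
      ∫ x, klFun (mixtureDensity ρ θ ε x) ∂(gaussianReal 0 1) := by
  have hac : μ ≪ gaussianReal 0 1 := hμ ▸ withDensity_absolutelyContinuous _ _
  have hrn : μ.rnDeriv (gaussianReal 0 1) =ᵐ[gaussianReal 0 1]
      fun x => ENNReal.ofReal (mixtureDensity ρ θ ε x) := by
    rw [hμ]
    exact Measure.rnDeriv_withDensity _ (measurable_mixtureDensity θ ε).ennreal_ofReal
  have hk : (fun x => klFun (μ.rnDeriv (gaussianReal 0 1) x).toReal) =ᵐ[gaussianReal 0 1]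
      fun x => klFun (mixtureDensity ρ θ ε x) := by
    filter_upwards [hrn] with x hx
    rw [hx, ENNReal.toReal_ofReal (mixtureDensity_nonneg hθ ε x)]
  have hi := integrable_klFun_mixtureDensity (ρ := ρ) hθ hint ε
  constructor
  · rw [klDiv_eq_lintegral_klFun_of_ac hac]
    exact (hi.congr hk.symm).lintegral_lt_top.ne
  · rw [toReal_klDiv_eq_integral_klFun hac, integral_congr_ae hk]

/-- With `ε = 1/σ` and `θ = Var Z · ε²`, the relation `σ² = Var Z + s²` reads `ε² s² = 1 - θ`;
positive noise is what gives `θ < 1`. -/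
lemma nonGaussianity_add_noise (hZ : MemLp Z 2 P) (hs : 0 < s)
    (hN : HasLaw N (gaussianReal 0 (Real.toNNReal (s ^ 2))) P) (hind : IndepFun Z N P) :
    nonGaussianity (fun ω => Z ω + N ω) P ≠ ∞ ∧
      (nonGaussianity (fun ω => Z ω + N ω) P).toReal =
        ∫ x, klFun (mixtureDensity (P.map fun ω => Z ω - P[Z])
          (Var[Z; P] * (1 / stdDev (fun ω => Z ω + N ω) P) ^ 2)
          (1 / stdDev (fun ω => Z ω + N ω) P) x) ∂(gaussianReal 0 1) := by
  set σ := stdDev (fun ω => Z ω + N ω) P with hσdef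
  have hv : 0 ≤ Var[Z; P] := variance_nonneg _ _
  have hσ2 : σ ^ 2 = Var[Z; P] + s ^ 2 := by
    rw [hσdef, stdDev_add_noise hZ hN hind, Real.sq_sqrt (by positivity)]
  have hσ2pos : 0 < σ ^ 2 := by rw [hσ2]; positivity
  have hσne : σ ≠ 0 := fun h => by simp [h] at hσ2pos
  have hεθ : (1 / σ) ^ 2 * s ^ 2 = 1 - Var[Z; P] * (1 / σ) ^ 2 := by
    rw [div_pow, one_pow]
    field_simp
    linarith
  have hθ : Var[Z; P] * (1 / σ) ^ 2 < 1 := by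
    have : 0 < (1 / σ) ^ 2 * s ^ 2 := by
      rw [div_pow, one_pow]
      positivity
    linarith
  have hZm : AEMeasurable (fun ω => Z ω - P[Z]) P := hZ.aemeasurable.sub_const _
  have hprob := Measure.isProbabilityMeasure_map (μ := P) hZm
  have hlaw := map_standardized_eq_withDensity hZ.aemeasurable hN hind P[Z] hθ hεθ
  have hfun : (fun ω => (Z ω + N ω - ∫ ω, (Z ω + N ω) ∂P) / σ) =
      fun ω => 1 / σ * (Z ω - P[Z]) + 1 / σ * N ω := by
    ext ω
    rw [integral_add_noise (hZ.integrable one_le_two) hN]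
    ring
  rw [← hfun] at hlaw
  have hYm : AEMeasurable (fun ω => (Z ω + N ω - ∫ ω, (Z ω + N ω) ∂P) / σ) P :=
    ((hZ.aemeasurable.add hN.aemeasurable).sub_const _).div_const _
  have hprob2 := Measure.isProbabilityMeasure_map (μ := P) hYm
  refine klDiv_withDensity_mixtureDensity hθ ?_ (1 / σ) hlaw
  rw [integrable_map_measure (by fun_prop) hZm]
  exact (hZ.sub (memLp_const _)).integrable_sq

lemma integral_centered (hZ : Integrable Z P) :
    ∫ z, z ∂(P.map fun ω => Z ω - P[Z]) = 0 := by
  rw [integral_map (hZ.aemeasurable.sub_const _) (by fun_prop), integral_sub hZ (integrable_const _)]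
  simp

/-- A translation adds only a linear term to the logarithm of the characteristic function. -/
lemma cumulant_centered {k : ℕ} (hk : 3 ≤ k) (hZ : MemLp Z k P) (a : ℝ) :
    cumulant id (P.map fun ω => Z ω - a) k = cumulant Z P k := by
  have hm : AEMeasurable (fun ω => Z ω - a) P := hZ.aemeasurable.sub_const a
  have hprob := Measure.isProbabilityMeasure_map (μ := P) hm
  refine cumulant_eq_of_charFun_eq (a := -a * Complex.I) (b := 0) measurable_id.aemeasurable hk hZ
    fun t => ?_
  have h : P.map (fun ω => Z ω - a) = (P.map Z).map (· + (-a)) := by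
    rw [AEMeasurable.map_map_of_aemeasurable (by fun_prop) hZ.aemeasurable]
    rfl
  rw [Measure.map_id, h, charFun_map_add_const]
  congr 2
  simp
  ring

lemma divergenceCoeff_congr (α : (k : ℕ) → Nat.Partition (2 * k) → ℝ) {m m' : ℕ → ℝ} {k : ℕ}
    (h : ∀ j ≤ 2 * k, m j = m' j) : divergenceCoeff α m k = divergenceCoeff α m' k := by
  rw [divergenceCoeff, divergenceCoeff, h k (by omega)]
  congr 1
  refine Finset.sum_congr rfl fun p _ => ?_
  rw [Multiset.map_congr rfl fun j hj => h j ?_]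
  have := Multiset.le_sum_of_mem hj
  rwa [p.parts_sum] at this

end NoisyVariable

/-! ### Assembly of the expansion. -/

theorem theorem2 :
    ∃ α : (k : ℕ) → Nat.Partition (2 * k) → ℝ,
      ∀ {Ω : Type*} [MeasurableSpace Ω] (P : Measure Ω) [IsProbabilityMeasure P]
        (K : ℕ) (_ : 3 ≤ K)
        (Z : Ω → ℝ) (_ : MemLp Z (2 * K : ℕ) P)
        (N : ℝ → Ω → ℝ)
        (_ : ∀ s : ℝ, 0 < s → HasLaw (N s) (gaussianReal 0 (Real.toNNReal (s ^ 2))) P)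
        (_ : ∀ s : ℝ, 0 < s → IndepFun Z (N s) P),
        -- the cumulants of order `≥ 3` of `Y = Z + N` do not depend on the noise level
        (∀ s : ℝ, 0 < s → ∀ k : ℕ, 3 ≤ k → k ≤ 2 * K →
          cumulant (fun ω => Z ω + N s ω) P k = cumulant Z P k) ∧
        -- the divergence is finite
        (∀ s : ℝ, 0 < s → nonGaussianity (fun ω => Z ω + N s ω) P ≠ ∞) ∧
        -- the expansion, as the noise level tends to infinity
        (fun s : ℝ => (nonGaussianity (fun ω => Z ω + N s ω) P).toReal -
            ∑ k ∈ Finset.Icc 3 K,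
              divergenceCoeff α (modifiedMoment (cumulant Z P)) k /
                (2 * (k ! : ℝ) * stdDev (fun ω => Z ω + N s ω) P ^ (2 * k)))
          =o[atTop] (fun s : ℝ => 1 / stdDev (fun ω => Z ω + N s ω) P ^ (2 * K)) := by

  refine ⟨divergenceWeight, ?_⟩
  intro Ω _ P _ K hK Z hZ N hN hind
  have hZk : ∀ k : ℕ, k ≤ 2 * K → MemLp Z k P := fun k hk =>
    hZ.mono_exponent (by exact_mod_cast hk)
  have hZ2 : MemLp Z 2 P := hZk 2 (by omega)
  refine ⟨fun s hs k hk hkK => ?_, fun s hs => ?_, ?_⟩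
  · exact cumulant_eq_of_charFun_eq (hZ.aemeasurable.add (hN s hs).aemeasurable) hk (hZk k hkK)
      (charFun_add_noise hZ.aemeasurable (hN s hs) (hind s hs))
  · exact (nonGaussianity_add_noise hZ2 hs (hN s hs) (hind s hs)).1
  have hm : AEMeasurable (fun ω => Z ω - P[Z]) P := hZ.aemeasurable.sub_const _
  have hprob := Measure.isProbabilityMeasure_map (μ := P) hm
  set ρ := P.map fun ω => Z ω - P[Z] with hρ
  have hint : MemLp id (2 * K : ℕ) ρ := by
    rw [hρ, memLp_map_measure_iff (by fun_prop) hm]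
    exact hZ.sub (memLp_const _)
  have hmean : ∫ z, z ∂ρ = 0 := integral_centered (hZ2.integrable one_le_two)
  have hvar : ∫ z, z ^ 2 ∂ρ = Var[Z; P] := integral_sq_centered hZ.aemeasurable
  have hexp := (isLittleO_integral_klFun_mixtureDensity (by omega : 3 ≤ 2 * K) hint hmean).add
    (isLittleO_integral_klTaylor_hermiteSum (modifiedMoment (cumulant id ρ)) hK)
  simp only [sub_add_sub_cancel, hvar] at hexp
  have hσ : (fun s => stdDev (fun ω => Z ω + N s ω) P) =ᶠ[atTop]
      fun s => √(Var[Z; P] + s ^ 2) := by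
    filter_upwards [eventually_gt_atTop 0] with s hs
    exact stdDev_add_noise hZ2 (hN s hs) (hind s hs)
  have hσtop : Tendsto (fun s => stdDev (fun ω => Z ω + N s ω) P) atTop atTop := by
    refine Tendsto.congr' hσ.symm (Real.tendsto_sqrt_atTop.comp ?_)
    exact tendsto_atTop_add_const_left _ _ (tendsto_pow_atTop two_ne_zero)
  have hε : Tendsto (fun s => 1 / stdDev (fun ω => Z ω + N s ω) P) atTop
      (nhdsWithin 0 (Set.Ioi 0)) := by
    simp only [one_div]
    exact tendsto_inv_atTop_nhdsGT_zero.comp hσtop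
  -- The one-parameter expansion in `ε → 0+` is evaluated at `ε = 1/σ`, as `σ` tends to infinity
  -- with the noise.
  have hlim := hexp.comp_tendsto hε
  refine hlim.congr' ?_ ?_
  · filter_upwards [eventually_gt_atTop 0] with s hs
    simp only [Function.comp_apply]
    rw [← (nonGaussianity_add_noise hZ2 hs (hN s hs) (hind s hs)).2]
    congr 1
    refine Finset.sum_congr rfl fun k hk => ?_
    rw [Finset.mem_Icc] at hk
    -- Centring changes the first cumulant, but modified moments involve only cumulants of order at
    -- least 3, here of order at most `2k ≤ 2K`.
    have hcoef : divergenceCoeff divergenceWeight (modifiedMoment (cumulant id ρ)) k =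
        divergenceCoeff divergenceWeight (modifiedMoment (cumulant Z P)) k :=
      divergenceCoeff_congr _ fun j hj => modifiedMoment_congr fun i hi hij =>
        cumulant_centered hi (hZk i (by omega)) _
    rw [hcoef, one_div, inv_pow, ← div_eq_mul_inv, div_div]
  · refine Eventually.of_forall fun s => ?_
    simp only [Function.comp_apply, one_div, inv_pow]
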